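/- **Theorem (existence of root-elations).** Let $\mathcal S$ be a finite thick generalized quadrangle of order $(s,t)$, so $s,t\ge 2$, each line carries $s+1$ points and each point lies on $t+1$ lines. Let $x$ be a point and let $H$ be a group of automorphisms of $\mathcal S$ such that $(\mathcal S^x,H)$ is a skew translation generalized quadrangle; that is, $H$ fixes every line on $x$, acts sharply transitively on the points not collinear with $x$, and contains a subgroup consisting of $t$ symmetries with center $x$ (automorphisms fixing every line on $x$ and every point collinear with $x$). Let $\mathbb S$ be the group of all symmetries with center $x$ in $H$. Assume that - (*) whenever an element of $H$ fixes a point $y\ne x$ collinear with $x$, it fixes every point of the line $xy$; - $s\neq t$ if $s$ is even; - for every affine line $L$ (a line not incident with $x$), the stabilizer $H_L$ is elementary abelian. For an affine line $L$ let $u=\mathrm{proj}_Lx$ be the unique point of $L$ collinear with $x$. Then for every affine line $L$ at least $s/t$ elements of $H_L$ (the identity included) are root-elations with i-root $(x,xu,u)$, that is, automorphisms that fix every line on $x$, every line on $u$ and every point of the line $xu$. If $s\ne t$, then $s/t>1$. Moreover, $\mathbb S$ is elementary abelian. -/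

import Mathlib

/-- A finite generalized quadrangle of order `(s, t)` with points `P` and lines `B`. -/
structure GenQuad (P B : Type*) (s t : ℕ) where
  /-- the incidence relation -/
  inc : P → B → Prop
  /-- every line is incident with exactly `s + 1` points -/
  ncard_points : ∀ L : B, {p : P | inc p L}.ncard = s + 1
  /-- every point is incident with exactly `t + 1` lines -/
  ncard_lines : ∀ p : P, {L : B | inc p L}.ncard = t + 1
  /-- two distinct points are incident with at most one common line -/
  eq_of_inc : ∀ (p q : P) (L M : B), p ≠ q → inc p L → inc q L → inc p M → inc q M → L = M
  /-- for `p` not on `L` there is a unique flag `(q, M)` with `p I M I q I L`;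
  then `q` is `proj_L p` and `M` is `proj_p L` -/
  existsUnique_proj : ∀ (p : P) (L : B), ¬ inc p L →
    ∃! qM : P × B, inc p qM.2 ∧ inc qM.1 qM.2 ∧ inc qM.1 L

namespace GenQuad

variable {P B : Type*} {s t : ℕ}

/-- Collinearity `p ∼ q` (every point is collinear with itself). -/
def Collinear (Γ : GenQuad P B s t) (p q : P) : Prop :=
  ∃ L : B, Γ.inc p L ∧ Γ.inc q L

/-- The automorphism group: pairs consisting of a permutation of the points and a permutation
of the lines which together preserve incidence. -/
def Aut (Γ : GenQuad P B s t) : Subgroup (Equiv.Perm P × Equiv.Perm B) where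
  carrier := {g | ∀ (p : P) (L : B), Γ.inc (g.1 p) (g.2 L) ↔ Γ.inc p L}
  one_mem' := fun _ _ => Iff.rfl
  mul_mem' := fun {g h} hg hh p L => (hg (h.1 p) (h.2 L)).trans (hh p L)
  inv_mem' := fun {g} hg p L => by
    have h := hg (g.1⁻¹ p) (g.2⁻¹ L)
    simpa using h.symm

/-- The automorphism `g` fixes every line on the point `p` (that is, `g` is a whorl about `p`). -/
def FixesLinewise (Γ : GenQuad P B s t) (p : P) (g : Equiv.Perm P × Equiv.Perm B) : Prop :=
  ∀ L : B, Γ.inc p L → g.2 L = L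

/-- The automorphism `g` fixes every point on the line `L`. -/
def FixesPointwise (Γ : GenQuad P B s t) (L : B) (g : Equiv.Perm P × Equiv.Perm B) : Prop :=
  ∀ p : P, Γ.inc p L → g.1 p = p

/-- The group of symmetries with center `x`: the whorls about `x` that fix `x^⊥` pointwise. -/
def symmetries (Γ : GenQuad P B s t) (x : P) : Subgroup (Equiv.Perm P × Equiv.Perm B) where
  carrier := {g | g ∈ Γ.Aut ∧ Γ.FixesLinewise x g ∧ ∀ y : P, Γ.Collinear x y → g.1 y = y}
  one_mem' := ⟨Γ.Aut.one_mem, fun _ _ => rfl, fun _ _ => rfl⟩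
  mul_mem' := by
    rintro g h ⟨hg, hg1, hg2⟩ ⟨hh, hh1, hh2⟩
    refine ⟨Γ.Aut.mul_mem hg hh, fun L hL => ?_, fun y hy => ?_⟩
    · simp [hh1 L hL, hg1 L hL]
    · simp [hh2 y hy, hg2 y hy]
  inv_mem' := by
    rintro g ⟨hg, hg1, hg2⟩
    refine ⟨Γ.Aut.inv_mem hg, fun L hL => ?_, fun y hy => ?_⟩
    · exact Equiv.Perm.inv_eq_iff_eq.mpr (hg1 L hL).symm
    · exact Equiv.Perm.inv_eq_iff_eq.mpr (hg2 y hy).symm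

/-- The group `A(x, M, u)` of root-elations with i-root `(x, M, u)`, where `x I M I u ≠ x`:
the automorphisms fixing every line on `x`, every line on `u` and every point on `M`. -/
def rootElations (Γ : GenQuad P B s t) (x : P) (M : B) (u : P) :
    Subgroup (Equiv.Perm P × Equiv.Perm B) where
  carrier := {g | g ∈ Γ.Aut ∧ Γ.FixesLinewise x g ∧ Γ.FixesLinewise u g ∧ Γ.FixesPointwise M g}
  one_mem' := ⟨Γ.Aut.one_mem, fun _ _ => rfl, fun _ _ => rfl, fun _ _ => rfl⟩
  mul_mem' := by
    rintro g h ⟨hg, hg1, hg2, hg3⟩ ⟨hh, hh1, hh2, hh3⟩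
    refine ⟨Γ.Aut.mul_mem hg hh, fun L hL => ?_, fun L hL => ?_, fun y hy => ?_⟩
    · simp [hh1 L hL, hg1 L hL]
    · simp [hh2 L hL, hg2 L hL]
    · simp [hh3 y hy, hg3 y hy]
  inv_mem' := by
    rintro g ⟨hg, hg1, hg2, hg3⟩
    refine ⟨Γ.Aut.inv_mem hg, fun L hL => ?_, fun L hL => ?_, fun y hy => ?_⟩
    · exact Equiv.Perm.inv_eq_iff_eq.mpr (hg1 L hL).symm
    · exact Equiv.Perm.inv_eq_iff_eq.mpr (hg2 L hL).symm
    · exact Equiv.Perm.inv_eq_iff_eq.mpr (hg3 y hy).symm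

/-- `(Γ^x, H)` is an elation generalized quadrangle: `H` is a group of automorphisms which
fixes `x` linewise and acts sharply transitively on the points not collinear with `x`. -/
structure IsEGQ (Γ : GenQuad P B s t) (x : P) (H : Subgroup (Equiv.Perm P × Equiv.Perm B)) :
    Prop where
  le_aut : H ≤ Γ.Aut
  linewise : ∀ g ∈ H, Γ.FixesLinewise x g
  sharplyTransitive : ∀ y z : P, ¬ Γ.Collinear x y → ¬ Γ.Collinear x z →
    ∃! g : Equiv.Perm P × Equiv.Perm B, g ∈ H ∧ g.1 y = z

/-- The group `𝕊` of the symmetries with center `x` contained in `H`. -/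
def symmetryGroup (Γ : GenQuad P B s t) (x : P) (H : Subgroup (Equiv.Perm P × Equiv.Perm B)) :
    Subgroup (Equiv.Perm P × Equiv.Perm B) :=
  H ⊓ Γ.symmetries x

/-- `(Γ^x, H)` is a skew translation generalized quadrangle: an elation generalized quadrangle
such that `H` contains a subgroup consisting of `t` symmetries with center `x`. -/
structure IsSTGQ (Γ : GenQuad P B s t) (x : P) (H : Subgroup (Equiv.Perm P × Equiv.Perm B)) :
    Prop extends Γ.IsEGQ x H where
  exists_symmetries : ∃ S : Subgroup (Equiv.Perm P × Equiv.Perm B),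
    S ≤ Γ.symmetryGroup x H ∧ Nat.card S = t

/-- Property (*): if an element of `H` fixes a point `y ∼ x`, `y ≠ x`, then it fixes every point
of the line `yx`. -/
def HasStar (Γ : GenQuad P B s t) (x : P) (H : Subgroup (Equiv.Perm P × Equiv.Perm B)) : Prop :=
  ∀ g ∈ H, ∀ (y : P) (M : B), y ≠ x → Γ.inc x M → Γ.inc y M → g.1 y = y → Γ.FixesPointwise M g

end GenQuad

/-- The stabilizer `H_L` in `H` of the line `L`. -/
def lineStabilizer {P B : Type*} (H : Subgroup (Equiv.Perm P × Equiv.Perm B)) (L : B) :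
    Subgroup (Equiv.Perm P × Equiv.Perm B) where
  carrier := {g | g ∈ H ∧ g.2 L = L}
  one_mem' := ⟨H.one_mem, rfl⟩
  mul_mem' := by
    rintro g h ⟨hg, hg1⟩ ⟨hh, hh1⟩
    exact ⟨H.mul_mem hg hh, by simp [hh1, hg1]⟩
  inv_mem' := by
    rintro g ⟨hg, hg1⟩
    exact ⟨H.inv_mem hg, Equiv.Perm.inv_eq_iff_eq.mpr hg1.symm⟩

/-- The subgroup `A` is elementary abelian: it is abelian and, for some prime `p`, all its
elements satisfy `a ^ p = 1`. -/
def IsElementaryAbelian {G : Type*} [Group G] (A : Subgroup G) : Prop :=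
  (∀ a ∈ A, ∀ b ∈ A, a * b = b * a) ∧ ∃ p : ℕ, p.Prime ∧ ∀ a ∈ A, a ^ p = 1

/-! Choose one affine line on each line M through x. Its stabilizer A_M, the pointwise stabilizers
K_M of the lines M, and 𝕊 form a Kantor family in H: |H| = s²t, K_M = A_M𝕊, distinct K_M meet in 𝕊,
and H' ≤ 𝕊. Counting the union of the K_M gives t ≤ s.

The geometric input is Benson's trace congruence (`GenQuad.benson`). An element of K_M outside 𝕊
fixing no affine line that meets M would force s + t to divide st, which the parity hypothesis
excludes for a prime power s ≥ t. So all of K_M outside 𝕊 is conjugate into A_M; since H' ≤ 𝕊 and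
A_M ∩ 𝕊 = 1, the class of each nontrivial a in A_M is the full coset a𝕊 (`exists_conj_eq_mul`).

The rest is group theory. 𝕊 has exponent dividing p and H is a p-group, hence nilpotent. Nilpotency
makes A_M and any nontrivial b from another A_N generate a group containing 𝕊, so the centralizer of
b in A_M, of index at most t, centralizes 𝕊; its elements are the root-elations. If t < s, a
nontrivial a in A_M centralizes 𝕊, and so do its conjugates aσ, whence 𝕊 is abelian. If s = t, the
K_M cover H and a character count (`commute_of_conj_coset`) makes 𝕊 central. -/

open scoped commutatorElement

/-! ### Characters and a criterion for centrality -/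

/-- A group of complex characters which are all trivial on `N` has at most as many elements as
`N` has cosets. -/
theorem card_characters_le_index {G : Type*} [Group G] [Finite G] (N : Subgroup G)
    (R : Subgroup (G →* ℂˣ)) (hR : ∀ f ∈ R, ∀ n ∈ N, f n = 1) : Nat.card R ≤ N.index := by
  classical
  have : Fintype (G ⧸ N) := Fintype.ofFinite _
  let F : R → (G ⧸ N) → ℂ := fun f => Quotient.lift (fun g => ((f.1 g : ℂˣ) : ℂ)) (by
    intro a b hab
    have h1 : a⁻¹ * b ∈ N := QuotientGroup.leftRel_apply.mp hab
    have h2 := hR f.1 f.2 _ h1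
    rw [map_mul, map_inv, inv_mul_eq_one] at h2
    simp only [h2])
  -- Distinct characters are linearly independent (Dedekind), and here they live in the space of
  -- functions on the cosets, of dimension the index.
  have hF : LinearIndependent ℂ F := by
    have h1 : LinearIndependent ℂ (fun f : R => ((Units.coeHom ℂ).comp f.1 : G → ℂ)) := by
      refine (linearIndependent_monoidHom G ℂ).comp (fun f : R => (Units.coeHom ℂ).comp f.1) ?_
      intro f f' h
      ext g
      exact DFunLike.congr_fun h g
    exact LinearIndependent.of_comp
      (LinearMap.funLeft ℂ ℂ (QuotientGroup.mk : G → G ⧸ N)) h1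
  have h3 : Finite R := hF.finite
  have := Fintype.ofFinite R
  have h2 := hF.fintype_card_le_finrank
  rwa [Module.finrank_fintype_fun_eq_card, ← Nat.card_eq_fintype_card,
    ← Nat.card_eq_fintype_card] at h2

open scoped IsMulCommutative in
/-- If all elements outside the normal subgroup `S ≥ [G, G]` have `S`-cosets as conjugacy classes,
the commutators of `S` with `G` are central and `|S|³ ≤ |G|`, then `S` is central. -/
theorem commute_of_conj_coset_of_central {G : Type*} [Group G] [Finite G] (S : Subgroup G)
    [S.Normal] (hcomm : ∀ g h : G, ⁅g, h⁆ ∈ S)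
    (hcos : ∀ h, h ∉ S → ∀ σ ∈ S, ∃ g, g * h * g⁻¹ = h * σ)
    (hcard : Nat.card S * Nat.card S ≤ S.index)
    (hcen : ∀ g : G, ∀ σ ∈ S, ⁅g, σ⁆ ∈ Subgroup.center G) (g₀ : G) (σ₀ : G) (hσ₀ : σ₀ ∈ S) :
    ⁅g₀, σ₀⁆ = 1 := by
  classical
  by_contra hne
  obtain ⟨θ₀, hθ₀⟩ := CommGroup.exists_apply_ne_one_of_hasEnoughRootsOfUnity
    (Subgroup.center G) ℂ (a := ⟨⁅g₀, σ₀⁆, hcen g₀ σ₀ hσ₀⟩)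
    (fun h => hne (congrArg Subtype.val h))
  -- The value 1 off the center is a mere default: `θ` is only evaluated at central elements.
  let θ : G → ℂˣ := fun z => if h : z ∈ Subgroup.center G then θ₀ ⟨z, h⟩ else 1
  have θ_mul : ∀ a b, a ∈ Subgroup.center G → b ∈ Subgroup.center G → θ (a * b) = θ a * θ b := by
    intro a b ha hb
    simp only [θ, dif_pos ha, dif_pos hb, dif_pos (mul_mem ha hb), ← map_mul]
    rfl
  have θ_one : θ 1 = 1 := by
    have := θ_mul 1 1 (one_mem _) (one_mem _)
    simpa using this
  have hθ : θ ⁅g₀, σ₀⁆ ≠ 1 := by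
    simpa only [θ, dif_pos (hcen g₀ σ₀ hσ₀)] using hθ₀
  have conj_central : ∀ z ∈ Subgroup.center G, ∀ g, g * z * g⁻¹ = z := by
    intro z hz g
    rw [Subgroup.mem_center_iff.mp hz g, mul_inv_cancel_right]
  have comm_mul_left : ∀ g h : G, ∀ σ ∈ S, ⁅g * h, σ⁆ = ⁅g, σ⁆ * ⁅h, σ⁆ := by
    intro g h σ hσ
    have h1 := conj_central _ (hcen h σ hσ) g
    have h2 : ⁅g * h, σ⁆ = (g * ⁅h, σ⁆ * g⁻¹) * ⁅g, σ⁆ := by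
      simp only [commutatorElement_def]; group
    rw [h2, h1, Subgroup.mem_center_iff.mp (hcen h σ hσ)]
  have comm_mul_right : ∀ g : G, ∀ σ ∈ S, ∀ τ ∈ S, ⁅g, σ * τ⁆ = ⁅g, σ⁆ * ⁅g, τ⁆ := by
    intro g σ hσ τ hτ
    have h1 := conj_central _ (hcen g τ hτ) σ
    have h2 : ⁅g, σ * τ⁆ = ⁅g, σ⁆ * (σ * ⁅g, τ⁆ * σ⁻¹) := by
      simp only [commutatorElement_def]; group
    rw [h2, h1]
  -- Commutators of `G` with `S` being central, `θ` of the commutator is a bimultiplicative pairing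
  -- of `G` with `S`.
  let Φ : G →* (S →* ℂˣ) :=
    { toFun := fun g =>
        { toFun := fun σ => θ ⁅g, (σ : G)⁆
          map_one' := by simp [θ_one]
          map_mul' := fun σ τ => by
            simp only [Subgroup.coe_mul]
            rw [comm_mul_right g σ σ.2 τ τ.2, θ_mul _ _ (hcen g σ σ.2) (hcen g τ τ.2)] }
      map_one' := by ext σ; simp [θ_one]
      map_mul' := fun g h => by
        ext σ
        simp only [MonoidHom.coe_mk, OneHom.coe_mk, MonoidHom.mul_apply]
        rw [comm_mul_left g h σ σ.2, θ_mul _ _ (hcen g σ σ.2) (hcen h σ σ.2)] }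
  have Φ_apply : ∀ (g : G) (σ : S), Φ g σ = θ ⁅g, (σ : G)⁆ := fun _ _ => rfl
  have Φ_cen : ∀ (g : G) (σ : S), (σ : G) ∈ Subgroup.center G → Φ g σ = 1 := by
    intro g σ hσ
    rw [Φ_apply, commutatorElement_eq_one_iff_mul_comm.mpr (Subgroup.mem_center_iff.mp hσ g), θ_one]
  set K := Φ.ker with hK
  have hKS : ∀ k ∈ K, ∀ σ ∈ S, θ ⁅k, σ⁆ = 1 := by
    intro k hk σ hσ
    have := DFunLike.congr_fun (MonoidHom.mem_ker.mp hk) (⟨σ, hσ⟩ : S)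
    simpa [Φ_apply] using this
  -- the index of `K` is small
  have hidx : K.index < Nat.card S := by
    -- Every `Φ g` kills the nontrivial central element `τ₀`, so there are at most |S| / |⟨τ₀⟩| such
    -- characters.
    let τ₀ : S := ⟨⁅g₀, σ₀⁆, hcomm _ _⟩
    have h1 : Nat.card Φ.range ≤ (Subgroup.zpowers τ₀).index := by
      apply card_characters_le_index
      rintro _ ⟨g, rfl⟩ n hn
      obtain ⟨m, rfl⟩ := Subgroup.mem_zpowers_iff.mp hn
      rw [map_zpow, Φ_cen g τ₀ (hcen _ _ hσ₀), one_zpow]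
    rw [hK, Subgroup.index_ker]
    refine h1.trans_lt ?_
    have h2 := (Subgroup.zpowers τ₀).card_mul_index
    have h3 : 1 < Nat.card (Subgroup.zpowers τ₀) := by
      rw [Subgroup.one_lt_card_iff_ne_bot, Ne, Subgroup.zpowers_eq_bot]
      exact fun h => hne (congrArg Subtype.val h)
    have h4 : 0 < (Subgroup.zpowers τ₀).index := Nat.pos_of_ne_zero Subgroup.index_ne_zero_of_finite
    nlinarith
  -- Three subgroups argument: by the Hall–Witt identity the commutator of `g₀` with [k, k'] is a
  -- product of commutators of `K` with `S`, on which `θ` is trivial.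
  have hlam : ∀ k ∈ K, ∀ k' ∈ K, Φ g₀ ⟨⁅k, k'⁆, hcomm _ _⟩ = 1 := by
    intro k hk k' hk'
    have e : ∀ a b c : G, ⁅⁅a, b⁆, c⁆ ∈ Subgroup.center G := by
      intro a b c
      rw [← inv_mem_iff, commutatorElement_inv]
      exact hcen _ _ (hcomm _ _)
    have hw : (k⁻¹ * ⁅⁅k, k'⁆, g₀⁆ * k⁻¹⁻¹) * (g₀ * ⁅⁅g₀⁻¹, k⁻¹⁆, k'⁆ * g₀⁻¹) *
        (k' * ⁅⁅k'⁻¹, g₀⁆, k⁻¹⁆ * k'⁻¹) = 1 := by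
      have := conj_commutatorElement_left_commutatorElement_mul k⁻¹ k' g₀
      simpa only [inv_inv, mul_assoc] using this
    rw [conj_central _ (e _ _ _), conj_central _ (e _ _ _), conj_central _ (e _ _ _)] at hw
    have h6 : ⁅g₀, ⁅k, k'⁆⁆ = ⁅k', ⁅g₀⁻¹, k⁻¹⁆⁆⁻¹ * ⁅k⁻¹, ⁅k'⁻¹, g₀⁆⁆⁻¹ := by
      rw [← commutatorElement_inv, inv_eq_iff_mul_eq_one, commutatorElement_inv,
        commutatorElement_inv, ← mul_assoc, hw]
    have θ_inv : ∀ a ∈ Subgroup.center G, θ a = 1 → θ a⁻¹ = 1 := by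
      intro a ha h
      have := θ_mul a a⁻¹ ha (inv_mem ha)
      rwa [mul_inv_cancel, θ_one, h, one_mul, eq_comm] at this
    rw [Φ_apply]
    change θ ⁅g₀, ⁅k, k'⁆⁆ = 1
    rw [h6, θ_mul _ _ (inv_mem (hcen _ _ (hcomm _ _))) (inv_mem (hcen _ _ (hcomm _ _))),
      θ_inv _ (hcen _ _ (hcomm _ _)) (hKS k' hk' _ (hcomm _ _)),
      θ_inv _ (hcen _ _ (hcomm _ _)) (hKS _ (inv_mem hk) _ (hcomm _ _)), one_mul]
  have Φ_conj : ∀ (g : G) (σ : G) (hσ : σ ∈ S) (h : G) (hσ' : h * σ * h⁻¹ ∈ S),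
      Φ g ⟨h * σ * h⁻¹, hσ'⟩ = Φ g ⟨σ, hσ⟩ := by
    intro g σ hσ h hσ'
    have h1 : (⟨h * σ * h⁻¹, hσ'⟩ : S) = ⟨⁅h, σ⁆, hcomm _ _⟩ * ⟨σ, hσ⟩ := by
      ext; simp [commutatorElement_def]
    rw [h1, map_mul, Φ_cen g ⟨⁅h, σ⁆, hcomm _ _⟩ (hcen _ _ hσ), one_mul]
  -- The character `Φ g₀` of `S` is invariant under conjugation, which makes its value at [k, g]
  -- multiplicative in both arguments.
  let Ψ : K →* (G →* ℂˣ) :=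
    { toFun := fun k =>
        { toFun := fun g => Φ g₀ ⟨⁅(k : G), g⁆, hcomm _ _⟩
          map_one' := by
            have : (⟨⁅(k : G), 1⁆, hcomm _ _⟩ : S) = 1 := by ext; simp
            rw [this, map_one]
          map_mul' := fun g h => by
            have h0 : g * ⁅(k : G), h⁆ * g⁻¹ ∈ S := Subgroup.Normal.conj_mem ‹_› _ (hcomm _ _) _
            have h1 : (⟨⁅(k : G), g * h⁆, hcomm _ _⟩ : S)
                = ⟨⁅(k : G), g⁆, hcomm _ _⟩ * ⟨g * ⁅(k : G), h⁆ * g⁻¹, h0⟩ := by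
              ext; simp only [Subgroup.coe_mul, commutatorElement_def]; group
            rw [h1, map_mul, Φ_conj g₀ _ (hcomm _ _)] }
      map_one' := by
        ext g
        have : (⟨⁅((1 : K) : G), g⁆, hcomm _ _⟩ : S) = 1 := by ext; simp
        simp only [MonoidHom.coe_mk, OneHom.coe_mk, this, map_one, MonoidHom.one_apply]
      map_mul' := fun k l => by
        ext g
        have h0 : (k : G) * ⁅(l : G), g⁆ * (k : G)⁻¹ ∈ S :=
          Subgroup.Normal.conj_mem ‹_› _ (hcomm _ _) _
        have h1 : (⟨⁅((k * l : K) : G), g⁆, hcomm _ _⟩ : S)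
            = ⟨(k : G) * ⁅(l : G), g⁆ * (k : G)⁻¹, h0⟩ * ⟨⁅(k : G), g⁆, hcomm _ _⟩ := by
          ext; simp only [Subgroup.coe_mul, commutatorElement_def]; group
        simp only [MonoidHom.coe_mk, OneHom.coe_mk, MonoidHom.mul_apply, h1, map_mul,
          Φ_conj g₀ _ (hcomm _ _), mul_comm] }
  have hΨ1 : Nat.card Ψ.range ≤ K.index := by
    apply card_characters_le_index
    rintro _ ⟨k, rfl⟩ n hn
    exact hlam k k.2 n hn
  -- The kernel lies in `S`: for k outside `S` the class of k⁻¹ is a full coset, so some [k, g]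
  -- equals `σ₀`, where `Φ g₀` is not 1.
  have hΨ2 : Nat.card Ψ.ker ≤ Nat.card S := by
    refine Nat.card_le_card_of_injective
      (fun k : Ψ.ker => (⟨((k : K) : G), ?_⟩ : S)) ?_
    · by_contra hk
      have hk' : ((k : K) : G)⁻¹ ∉ S := fun h => hk (inv_mem_iff.mp h)
      obtain ⟨g, hg⟩ := hcos _ hk' σ₀ hσ₀
      have h1 := DFunLike.congr_fun (MonoidHom.mem_ker.mp k.2) g
      have h2 : ⁅((k : K) : G), g⁆ = σ₀ := by
        rw [commutatorElement_def, mul_assoc, mul_assoc, ← mul_assoc g, hg, mul_inv_cancel_left]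
      apply hθ
      calc θ ⁅g₀, σ₀⁆ = Φ g₀ ⟨⁅((k : K) : G), g⁆, hcomm _ _⟩ := by rw [Φ_apply]; simp only [h2]
        _ = 1 := h1
    · intro a b hab
      ext
      exact congrArg (fun z : S => (z : G)) hab
  have c1 := Ψ.ker.card_mul_index
  rw [Subgroup.index_ker] at c1
  have c2 := K.card_mul_index
  have c3 := S.card_mul_index
  have hS : 0 < Nat.card S := Nat.card_pos
  -- Hence [G : S] ≤ [G : K]² < |S|², against `hcard`.
  have c4 : Nat.card K ≤ Nat.card S * K.index := c1 ▸ Nat.mul_le_mul hΨ2 hΨ1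
  have c5 : S.index ≤ K.index * K.index := by
    refine Nat.le_of_mul_le_mul_left ?_ hS
    rw [c3, ← c2, ← mul_assoc]
    exact Nat.mul_le_mul_right _ c4
  nlinarith

/-- In a nilpotent group, a normal subgroup `S ≥ [G, G]` with `|S|³ ≤ |G|` is central if all
elements outside of it have `S`-cosets as conjugacy classes. -/
theorem commute_of_conj_coset {G : Type*} [Group G] [Finite G] [Group.IsNilpotent G]
    (S : Subgroup G) [S.Normal] (hcomm : ∀ g h : G, ⁅g, h⁆ ∈ S)
    (hcos : ∀ h, h ∉ S → ∀ σ ∈ S, ∃ g, g * h * g⁻¹ = h * σ)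
    (hcard : Nat.card S * Nat.card S ≤ S.index) (g : G) (σ : G) (hσ : σ ∈ S) :
    ⁅g, σ⁆ = 1 := by
  set T : Subgroup G := ⁅(⊤ : Subgroup G), S⁆ with hT
  set U : Subgroup G := ⁅T, (⊤ : Subgroup G)⁆ with hU
  have hTS : T ≤ S := Subgroup.commutator_le_right _ _
  have hUT : U ≤ T := Subgroup.commutator_le_left _ _
  have hker : (QuotientGroup.mk' U).ker ≤ S := by
    rw [QuotientGroup.ker_mk']; exact hUT.trans hTS
  have hsurj := QuotientGroup.mk'_surjective U
  have hnorm : (S.map (QuotientGroup.mk' U)).Normal := Subgroup.Normal.map ‹_› _ hsurj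
  have hmem : ∀ g, QuotientGroup.mk' U g ∈ S.map (QuotientGroup.mk' U) → g ∈ S := by
    rintro g ⟨s, hs, hsg⟩
    have h1 : s⁻¹ * g ∈ (QuotientGroup.mk' U).ker := by
      rw [MonoidHom.mem_ker, map_mul, map_inv, hsg, inv_mul_cancel]
    simpa using mul_mem hs (hker h1)
  -- Modulo `U` the commutators of `G` with `S` are central, and the other hypotheses survive: the
  -- index of `S` is unchanged and its order can only drop.
  have key : T ≤ U := by
    rw [hT, Subgroup.commutator_le]
    intro g _ σ hσ
    have h := commute_of_conj_coset_of_central (S.map (QuotientGroup.mk' U)) ?_ ?_ ?_ ?_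
      (QuotientGroup.mk' U g) (QuotientGroup.mk' U σ) ⟨σ, hσ, rfl⟩
    · rw [← map_commutatorElement, ← MonoidHom.mem_ker, QuotientGroup.ker_mk'] at h
      exact h
    · intro a b
      obtain ⟨a, rfl⟩ := hsurj a
      obtain ⟨b, rfl⟩ := hsurj b
      rw [← map_commutatorElement]
      exact ⟨_, hcomm a b, rfl⟩
    · intro a ha b hb
      obtain ⟨a, rfl⟩ := hsurj a
      obtain ⟨b, hb, rfl⟩ := hb
      obtain ⟨c, hc⟩ := hcos a (fun h => ha ⟨a, h, rfl⟩) b hb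
      exact ⟨QuotientGroup.mk' U c, by rw [← map_mul, ← map_inv, ← map_mul, hc, map_mul]⟩
    · rw [Subgroup.index_map_eq S hsurj hker]
      have : Nat.card (S.map (QuotientGroup.mk' U)) ≤ Nat.card S :=
        Nat.card_le_card_of_surjective _ (MonoidHom.subgroupMap_surjective (QuotientGroup.mk' U) S)
      exact (Nat.mul_le_mul this this).trans hcard
    · intro a b hb
      obtain ⟨a, rfl⟩ := hsurj a
      obtain ⟨b, hb, rfl⟩ := hb
      rw [Subgroup.mem_center_iff]
      intro c
      obtain ⟨c, rfl⟩ := hsurj c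
      have h1 : ⁅⁅a, b⁆, c⁆ ∈ U := Subgroup.commutator_mem_commutator
        (Subgroup.commutator_mem_commutator (Subgroup.mem_top _) hb) (Subgroup.mem_top _)
      rw [← QuotientGroup.ker_mk' U, MonoidHom.mem_ker, map_commutatorElement,
        map_commutatorElement, commutatorElement_eq_one_iff_mul_comm] at h1
      exact h1.symm
  obtain ⟨n, hn⟩ := Subgroup.nilpotent_iff_lowerCentralSeries.mp ‹Group.IsNilpotent G›
  have hle : ∀ n, T ≤ (⊤ : Subgroup G).lowerCentralSeries n := by
    intro n
    induction n with
    | zero => exact le_top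
    | succ n ih =>
      rw [Subgroup.lowerCentralSeries_succ]
      exact key.trans (Subgroup.commutator_mono ih le_rfl)
  have h1 : ⁅g, σ⁆ ∈ T := Subgroup.commutator_mem_commutator (Subgroup.mem_top _) hσ
  have h2 := hle n h1
  rwa [hn, Subgroup.mem_bot] at h2

/-! ### Group theory of skew translation Kantor families -/

/-- A skew translation Kantor family: the subgroups `A i` are abelian of order `s`, the normal
subgroups `K i = A i * S` (the tangent spaces) meet pairwise in `S`, which has order `t`. -/
structure IsSkewKantorFamily {G ι : Type*} [Group G] (S : Subgroup G) (K A : ι → Subgroup G)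
    (s t : ℕ) : Prop where
  normal_base : S.Normal
  normal : ∀ i, (K i).Normal
  card_base : Nat.card S = t
  card_A : ∀ i, Nat.card (A i) = s
  card_K : ∀ i, Nat.card (K i) = s * t
  card_group : Nat.card G = s * (s * t)
  le : ∀ i, A i ≤ K i
  inf_eq : ∀ i j, i ≠ j → K i ⊓ K j = S
  disjoint : ∀ i j, i ≠ j → Disjoint (K i) (A j)
  mul_comm : ∀ i, ∀ a ∈ A i, ∀ b ∈ A i, a * b = b * a
  card_index : Nat.card ι = t + 1

namespace IsSkewKantorFamily

variable {G ι : Type*} [Group G] [Finite G] {S : Subgroup G} {K A : ι → Subgroup G} {s t : ℕ}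

theorem exists_ne (h : IsSkewKantorFamily S K A s t) (i : ι) : ∃ j, i ≠ j := by
  have h1 : 0 < t := h.card_base ▸ Nat.card_pos
  have : Finite ι := Nat.finite_of_card_ne_zero (by rw [h.card_index]; omega)
  have : Nontrivial ι := (Finite.one_lt_card_iff_nontrivial).mp (by rw [h.card_index]; omega)
  obtain ⟨j, hj⟩ := _root_.exists_ne i
  exact ⟨j, hj.symm⟩

theorem pos (h : IsSkewKantorFamily S K A s t) : 0 < s ∧ 0 < t := by
  have h1 : 0 < t := h.card_base ▸ Nat.card_pos
  have h2 : 0 < Nat.card G := Nat.card_pos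
  rw [h.card_group] at h2
  exact ⟨Nat.pos_of_mul_pos_right h2, h1⟩

theorem base_le (h : IsSkewKantorFamily S K A s t) (i : ι) : S ≤ K i := by
  obtain ⟨j, hij⟩ := h.exists_ne i
  rw [← h.inf_eq i j hij]
  exact inf_le_left

theorem base_disjoint (h : IsSkewKantorFamily S K A s t) (i : ι) : Disjoint S (A i) := by
  obtain ⟨j, hij⟩ := h.exists_ne i
  exact (h.disjoint j i hij.symm).mono_left (h.base_le j)

theorem eq_one_of_mem (h : IsSkewKantorFamily S K A s t) {i : ι} {g : G} (hS : g ∈ S)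
    (hA : g ∈ A i) : g = 1 :=
  Subgroup.disjoint_def.mp (h.base_disjoint i) hS hA

theorem exists_mul (h : IsSkewKantorFamily S K A s t) {i j : ι} (hij : i ≠ j) (g : G) :
    ∃ k ∈ K i, ∃ a ∈ A j, g = k * a := by
  have h1 : (K i).IsComplement' (A j) := Subgroup.isComplement'_of_card_mul_and_disjoint
    (by rw [h.card_K, h.card_A, h.card_group]; ring) (h.disjoint i j hij)
  obtain ⟨⟨k, a⟩, hka⟩ := h1.2 g
  exact ⟨k, k.2, a, a.2, hka.symm⟩

/-- Dedekind's modular law: G = K j * A i and A i ≤ K i give K i = (K i ⊓ K j) * A i. -/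
theorem exists_base_mul (h : IsSkewKantorFamily S K A s t) {i : ι} {g : G} (hg : g ∈ K i) :
    ∃ σ ∈ S, ∃ a ∈ A i, g = σ * a := by
  obtain ⟨j, hij⟩ := h.exists_ne i
  obtain ⟨k, hk, a, ha, rfl⟩ := h.exists_mul hij.symm g
  refine ⟨k, ?_, a, ha, rfl⟩
  rw [← h.inf_eq i j hij]
  exact ⟨((K i).mul_mem_cancel_right (h.le i ha)).mp hg, hk⟩

theorem exists_mul_base (h : IsSkewKantorFamily S K A s t) {i : ι} {g : G} (hg : g ∈ K i) :
    ∃ a ∈ A i, ∃ σ ∈ S, g = a * σ := by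
  obtain ⟨σ, hσ, a, ha, hga⟩ := h.exists_base_mul (inv_mem hg)
  exact ⟨a⁻¹, inv_mem ha, σ⁻¹, inv_mem hσ, by rw [← mul_inv_rev, ← hga, inv_inv]⟩

/-- G / K i is an image of the abelian group A j, so commutators lie in K i; likewise in K j, and K
i ⊓ K j = S. -/
theorem commutator_mem (h : IsSkewKantorFamily S K A s t) (hne : Nonempty ι) (x y : G) :
    ⁅x, y⁆ ∈ S := by
  have key : ∀ i j, i ≠ j → ⁅x, y⁆ ∈ K i := by
    intro i j hij
    have := h.normal i
    obtain ⟨k, hk, a, ha, rfl⟩ := h.exists_mul hij x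
    obtain ⟨l, hl, b, hb, rfl⟩ := h.exists_mul hij y
    rw [← QuotientGroup.eq_one_iff, ← QuotientGroup.mk'_apply, map_commutatorElement,
      commutatorElement_eq_one_iff_mul_comm, map_mul, map_mul]
    have hk' : QuotientGroup.mk' (K i) k = 1 := (QuotientGroup.eq_one_iff k).mpr hk
    have hl' : QuotientGroup.mk' (K i) l = 1 := (QuotientGroup.eq_one_iff l).mpr hl
    rw [hk', hl', one_mul, one_mul, ← map_mul, ← map_mul, h.mul_comm j a ha b hb]
  obtain ⟨i⟩ := hne
  obtain ⟨j, hij⟩ := h.exists_ne i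
  rw [← h.inf_eq i j hij]
  exact ⟨key i j hij, key j i hij.symm⟩

/-- The number of elements in the union of the tangent spaces. -/
theorem card_union (h : IsSkewKantorFamily S K A s t) :
    Nat.card {g : G // g ∉ S ∧ ∃ i, g ∈ K i} = (t + 1) * (s * t - t) := by
  classical
  have hfin : Finite ι := Nat.finite_of_card_ne_zero (by rw [h.card_index]; omega)
  have := Fintype.ofFinite ι
  have hc : ∀ i, Nat.card {g : G // g ∉ S ∧ g ∈ K i} = s * t - t := by
    intro i
    have h1 : ({g : G | g ∉ S ∧ g ∈ K i} : Set G) = (K i : Set G) \ (S : Set G) := by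
      ext g; exact and_comm
    have h2 := Set.ncard_sdiff_add_ncard_of_subset (s := (S : Set G)) (t := (K i : Set G))
      (h.base_le i) (Set.toFinite _)
    have h3 : (S : Set G).ncard = t := h.card_base
    have h4 : (K i : Set G).ncard = s * t := h.card_K i
    change ({g : G | g ∉ S ∧ g ∈ K i} : Set G).ncard = _
    rw [h1]; omega
  have e : Nat.card (Σ i, {g : G // g ∉ S ∧ g ∈ K i})
      = Nat.card {g : G // g ∉ S ∧ ∃ i, g ∈ K i} := by
    refine Nat.card_eq_of_bijective (fun x => ⟨x.2.1, x.2.2.1, x.1, x.2.2.2⟩) ⟨?_, ?_⟩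
    · rintro ⟨i, g, hg, hi⟩ ⟨j, g', hg', hj⟩ hx
      obtain rfl : g = g' := congrArg (fun z => z.1) hx
      by_cases hij : i = j
      · subst hij; rfl
      · exact absurd (h.inf_eq i j hij ▸ (⟨hi, hj⟩ : g ∈ K i ⊓ K j)) hg
    · rintro ⟨g, hg, i, hi⟩
      exact ⟨⟨i, g, hg, hi⟩, rfl⟩
  rw [← e, Nat.card_sigma]
  simp only [hc, Finset.sum_const, smul_eq_mul, Finset.card_univ, ← Nat.card_eq_fintype_card,
    h.card_index]

theorem card_compl_base (h : IsSkewKantorFamily S K A s t) :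
    Nat.card {g : G // g ∉ S} = s * (s * t) - t := by
  have h2 := Set.ncard_add_ncard_compl (S : Set G)
  have h3 : (S : Set G).ncard = t := h.card_base
  have h4 : Nat.card {g : G // g ∉ S} = (S : Set G)ᶜ.ncard := rfl
  rw [h.card_group] at h2
  omega

/-- Outside `S` the tangent spaces are disjoint, so (t + 1)(s - 1)t ≤ (s² - 1)t. -/
theorem le_of_one_lt (h : IsSkewKantorFamily S K A s t) (hs : 1 < s) : t ≤ s := by
  have h1 : Nat.card {g : G // g ∉ S ∧ ∃ i, g ∈ K i} ≤ Nat.card {g : G // g ∉ S} :=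
    Nat.card_le_card_of_injective (fun x => ⟨x.1, x.2.1⟩)
      (fun x y hxy => Subtype.ext (congrArg (fun z => z.1) hxy))
  rw [h.card_union, h.card_compl_base] at h1
  have ht := h.pos.2
  obtain ⟨r, rfl⟩ : ∃ r, s = r + 2 := ⟨s - 2, by omega⟩
  have e1 : (r + 2) * t - t = (r + 1) * t := by
    rw [show (r + 2) * t = (r + 1) * t + t by ring]; simp
  have e2 : (r + 2) * ((r + 2) * t) - t = (r + 3) * ((r + 1) * t) := by
    rw [show (r + 2) * ((r + 2) * t) = (r + 3) * ((r + 1) * t) + t by ring]; simp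
  rw [e1, e2] at h1
  have := Nat.le_of_mul_le_mul_right h1 (by positivity)
  omega

/-- For s = t the count that bounds t by s is an equality, so the tangent spaces cover the group. -/
theorem mem_tangent_of_card_eq (h : IsSkewKantorFamily S K A s t) (hs : 1 < s) (hst : s = t)
    (g : G) (hg : g ∉ S) : ∃ i, g ∈ K i := by
  have h1 : Nat.card {g : G // g ∉ S ∧ ∃ i, g ∈ K i} = Nat.card {g : G // g ∉ S} := by
    rw [h.card_union, h.card_compl_base, ← hst, Nat.mul_sub]
    obtain ⟨r, rfl⟩ : ∃ r, s = r + 2 := ⟨s - 2, by omega⟩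
    zify [show (r + 2 + 1) * (r + 2) ≤ (r + 2 + 1) * ((r + 2) * (r + 2)) by nlinarith,
      show (r + 2) ≤ (r + 2) * ((r + 2) * (r + 2)) by nlinarith]
    ring
  have h2 : Function.Injective (fun x : {g : G // g ∉ S ∧ ∃ i, g ∈ K i} =>
      (⟨x.1, x.2.1⟩ : {g : G // g ∉ S})) :=
    fun x y hxy => Subtype.ext (congrArg (fun z => z.1) hxy)
  obtain ⟨x, hx⟩ := ((Nat.bijective_iff_injective_and_card _).mpr ⟨h2, h1⟩).2 ⟨g, hg⟩
  have : x.1 = g := congrArg Subtype.val hx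
  exact this ▸ x.2.2

/-- If all elements of the tangent spaces outside `S` are conjugate to elements of the family, then
the conjugacy class of every `a ∈ A i`, `a ≠ 1`, is the coset `a * S`. -/
theorem exists_conj_eq_mul (h : IsSkewKantorFamily S K A s t)
    (hconj : ∀ i, ∀ g ∈ K i, g ∉ S → ∃ x, x * g * x⁻¹ ∈ A i) {i : ι} {a : G} (ha : a ∈ A i)
    (ha1 : a ≠ 1) {σ : G} (hσ : σ ∈ S) : ∃ x, x * a * x⁻¹ = a * σ := by
  have haS : a ∉ S := fun hS => ha1 (h.eq_one_of_mem hS ha)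
  obtain ⟨x, hx⟩ := hconj i (a * σ) (mul_mem (h.le i ha) (h.base_le i hσ))
    (fun hS => haS ((S.mul_mem_cancel_right hσ).mp hS))
  have h1 : ⁅x, a * σ⁆ ∈ S := h.commutator_mem ⟨i⟩ _ _
  have h2 : x * (a * σ) * x⁻¹ = a := by
    have h3 : x * (a * σ) * x⁻¹ * a⁻¹ ∈ S := by
      have : x * (a * σ) * x⁻¹ * a⁻¹ = ⁅x, a * σ⁆ * (a * σ * a⁻¹) := by
        rw [commutatorElement_def]; group
      rw [this]
      exact mul_mem h1 (h.normal_base.conj_mem σ hσ a)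
    exact mul_inv_eq_one.mp (h.eq_one_of_mem h3 (mul_mem hx (inv_mem ha)))
  refine ⟨x⁻¹, ?_⟩
  calc x⁻¹ * a * x⁻¹⁻¹ = x⁻¹ * (x * (a * σ) * x⁻¹) * x := by rw [h2]; group
    _ = a * σ := by group

/-- Since |A i| = s ≥ t exceeds the number of nontrivial elements of `S`, two elements of A i
conjugate σ alike, and some nontrivial c in A i commutes with σ. As cσ is conjugate to c, its p-th
power is 1, and so is that of σ. -/
theorem pow_prime_eq_one (h : IsSkewKantorFamily S K A s t) (hs : 1 < s)
    (hconj : ∀ i, ∀ g ∈ K i, g ∉ S → ∃ x, x * g * x⁻¹ ∈ A i) (i : ι) {p : ℕ}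
    (hp : ∀ a ∈ A i, a ^ p = 1) {σ : G} (hσ : σ ∈ S) : σ ^ p = 1 := by
  by_cases hσ1 : σ = 1
  · rw [hσ1, one_pow]
  let f : A i → {τ : S // τ ≠ 1} := fun a =>
    ⟨⟨a * σ * (a : G)⁻¹, h.normal_base.conj_mem σ hσ a⟩, by
      intro h1
      have h2 : (a : G) * σ * (a : G)⁻¹ = 1 := congrArg Subtype.val h1
      exact hσ1 (conj_eq_one_iff.mp h2)⟩
  have hf : ¬ Function.Injective f := by
    intro hf
    have h1 := Nat.card_le_card_of_injective f hf
    have h2 : Nat.card {τ : S // τ ≠ 1} < Nat.card S :=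
      Finite.card_subtype_lt (x := 1) (by simp)
    have h3 := h.le_of_one_lt hs
    rw [h.card_A] at h1
    rw [h.card_base] at h2
    omega
  simp only [Function.Injective, not_forall] at hf
  obtain ⟨a, b, hab, hne⟩ := hf
  have hab : (a : G) * σ * (a : G)⁻¹ = b * σ * (b : G)⁻¹ :=
    congrArg (fun z : {τ : S // τ ≠ 1} => ((z : S) : G)) hab
  set c : G := (b : G)⁻¹ * a with hc
  have hcA : c ∈ A i := mul_mem (inv_mem b.2) a.2
  have hc1 : c ≠ 1 := fun h1 => hne (Subtype.ext (inv_mul_eq_one.mp h1).symm)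
  have hcomm : Commute c σ := by
    have : c * σ = ((b : G)⁻¹ * (a * σ * (a : G)⁻¹)) * a := by rw [hc]; group
    rw [Commute, SemiconjBy, this, hab, hc]; group
  obtain ⟨x, hx⟩ := h.exists_conj_eq_mul hconj hcA hc1 hσ
  have h1 : (c * σ) ^ p = 1 := by rw [← hx, conj_pow, hp c hcA]; group
  rwa [hcomm.mul_pow, hp c hcA, one_mul] at h1

theorem isPGroup (h : IsSkewKantorFamily S K A s t) (hs : 1 < s)
    (hconj : ∀ i, ∀ g ∈ K i, g ∉ S → ∃ x, x * g * x⁻¹ ∈ A i) (i : ι) {p : ℕ} [Fact p.Prime]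
    (hp : ∀ a ∈ A i, a ^ p = 1) : IsPGroup p G := by
  have h1 : IsPGroup p S := fun σ => ⟨1, by
    ext; simpa using h.pow_prime_eq_one hs hconj i hp σ.2⟩
  have h2 : IsPGroup p (A i) := fun a => ⟨1, by ext; simpa using hp a a.2⟩
  obtain ⟨m, hm⟩ := h1.exists_card_eq
  obtain ⟨n, hn⟩ := h2.exists_card_eq
  rw [h.card_base] at hm
  rw [h.card_A] at hn
  apply IsPGroup.of_card (n := n + (n + m))
  rw [h.card_group, hm, hn, pow_add, pow_add]

/-- `S` is contained in the group generated by `A i` and a nontrivial element of `A j`. -/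
theorem base_le_closure (h : IsSkewKantorFamily S K A s t) [Group.IsNilpotent G]
    (hconj : ∀ i, ∀ g ∈ K i, g ∉ S → ∃ x, x * g * x⁻¹ ∈ A i) {i j : ι} (hij : i ≠ j) {b : G}
    (hb : b ∈ A j) (hb1 : b ≠ 1) {X : Subgroup G} (hAX : A i ≤ X) (hbX : b ∈ X) : S ≤ X := by
  by_contra hSX
  -- Take `Y` maximal among the subgroups not containing `S`; normalizers grow in a nilpotent group,
  -- so the normalizer of `Y` contains `S`.
  obtain ⟨Y, hXY, hY⟩ := (Set.toFinite {Y : Subgroup G | ¬ S ≤ Y}).exists_le_maximal hSX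
  have hYtop : Y < ⊤ := lt_top_iff_ne_top.mpr (fun h1 => hY.1 (h1 ▸ le_top))
  have hlt := Group.normalizerCondition_of_isNilpotent Y hYtop
  have hSN : S ≤ Subgroup.normalizer (Y : Set G) := by
    by_contra hn
    exact absurd (hY.2 hn hlt.le) (not_le_of_gt hlt)
  apply hY.1
  intro σ hσ
  obtain ⟨x, hx⟩ := h.exists_conj_eq_mul hconj hb hb1 hσ
  -- Write the conjugating element as aτc: here c commutes with b, while a and τ normalize `Y`. So
  -- bσ lies in `Y`, and then σ does.
  obtain ⟨k, hk, c, hc, rfl⟩ := h.exists_mul hij x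
  obtain ⟨a, ha, τ, hτ, rfl⟩ := h.exists_mul_base hk
  have h1 : (a * τ) * b * (a * τ)⁻¹ = b * σ := by
    rw [← hx]
    have := h.mul_comm j c hc b hb
    have h2 : c * b * c⁻¹ = b := by rw [this]; group
    calc (a * τ) * b * (a * τ)⁻¹ = (a * τ) * (c * b * c⁻¹) * (a * τ)⁻¹ := by rw [h2]
      _ = _ := by group
  have h2 : a * τ ∈ Subgroup.normalizer (Y : Set G) :=
    mul_mem (Subgroup.le_normalizer (hXY (hAX ha))) (hSN hτ)
  have h3 : (a * τ) * b * (a * τ)⁻¹ ∈ Y := (Subgroup.mem_normalizer_iff.mp h2 b).mp (hXY hbX)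
  rw [h1] at h3
  exact (Y.mul_mem_cancel_left (hXY hbX)).mp h3

/-- At least `s / t` elements of `A i` centralize `S`. -/
theorem le_card_centralizer (h : IsSkewKantorFamily S K A s t) (hs : 1 < s) [Group.IsNilpotent G]
    (hconj : ∀ i, ∀ g ∈ K i, g ∉ S → ∃ x, x * g * x⁻¹ ∈ A i) (i : ι) :
    s ≤ t * Nat.card ↥(A i ⊓ Subgroup.centralizer (S : Set G)) := by
  obtain ⟨j, hij⟩ := h.exists_ne i
  obtain ⟨b, hb, hb1⟩ : ∃ b ∈ A j, b ≠ 1 := by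
    have : A j ≠ ⊥ := by
      rw [← Subgroup.one_lt_card_iff_ne_bot, h.card_A]; exact hs
    exact (A j).bot_or_exists_ne_one.resolve_left this
  -- An element of A i commuting with b centralizes ⟨A i, b⟩, hence `S`.
  set D : Subgroup G := A i ⊓ Subgroup.centralizer {b} with hD
  have h1 : D ≤ A i ⊓ Subgroup.centralizer (S : Set G) := by
    refine le_inf inf_le_left ?_
    intro d hd
    have hA : A i ≤ Subgroup.centralizer {d} := fun a ha =>
      Subgroup.mem_centralizer_singleton_iff.mpr (h.mul_comm i _ hd.1 _ ha).symm
    have hbd : b ∈ Subgroup.centralizer {d} :=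
      Subgroup.mem_centralizer_singleton_iff.mpr
        (Subgroup.mem_centralizer_singleton_iff.mp hd.2).symm
    have hS := h.base_le_closure hconj hij hb hb1 hA hbd
    exact Subgroup.mem_centralizer_iff.mpr
      fun σ hσ => Subgroup.mem_centralizer_singleton_iff.mp (hS hσ)
  refine le_trans ?_ (Nat.mul_le_mul_left t (Subgroup.card_le_of_le h1))
  have h2 := (D.subgroupOf (A i)).card_mul_index
  have h3 : Nat.card (D.subgroupOf (A i)) = Nat.card D :=
    Nat.card_congr (Subgroup.subgroupOfEquivOfLe inf_le_left).toEquiv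
  rw [h.card_A, h3] at h2
  have h4 : (D.subgroupOf (A i)).index ≤ t := by
    rw [← h.card_base]
    -- The map a ↦ [a, b] takes values in `S` and separates the cosets of `D`, so the index is at
    -- most t.
    let f : (A i ⧸ D.subgroupOf (A i)) → S := Quotient.lift
      (fun a : A i => (⟨⁅(a : G), b⁆, h.commutator_mem ⟨i⟩ _ _⟩ : S)) (by
        intro a c hac
        have h5 : a⁻¹ * c ∈ D.subgroupOf (A i) := QuotientGroup.leftRel_apply.mp hac
        have h6 := Subgroup.mem_centralizer_singleton_iff.mp (Subgroup.mem_subgroupOf.mp h5).2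
        ext
        simp only [Subgroup.coe_mul, Subgroup.coe_inv] at h6
        simp only [commutatorElement_def]
        have h7 : (c : G) = a * ((a : G)⁻¹ * c) := by group
        have h8 : (c : G) * b * (c : G)⁻¹ = a * b * (a : G)⁻¹ := by
          calc (c : G) * b * (c : G)⁻¹ = a * (((a : G)⁻¹ * c) * b) * (c : G)⁻¹ := by group
            _ = a * b * (a : G)⁻¹ := by rw [h6]; group
        rw [h8])
    refine Nat.card_le_card_of_injective f ?_
    intro x y
    refine Quotient.inductionOn₂ x y ?_
    intro a c hac
    have h5 : ⁅(a : G), b⁆ = ⁅(c : G), b⁆ := congrArg Subtype.val hac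
    simp only [commutatorElement_def, mul_left_inj] at h5
    apply Quotient.sound
    refine QuotientGroup.leftRel_apply.mpr (Subgroup.mem_subgroupOf.mpr
      ⟨(a⁻¹ * c).2, Subgroup.mem_centralizer_singleton_iff.mpr ?_⟩)
    simp only [Subgroup.coe_mul, Subgroup.coe_inv]
    calc (a : G)⁻¹ * c * b = (a : G)⁻¹ * (c * b * (c : G)⁻¹) * c := by group
      _ = b * ((a : G)⁻¹ * c) := by rw [← h5]; group
  rw [← h2, Nat.mul_comm]
  exact Nat.mul_le_mul_right _ h4

/-- For s = t the tangent spaces cover the group, so all elements outside `S` have full cosets as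
classes and the character count applies. For t < s some a ≠ 1 in A i centralizes the normal subgroup
`S`, and so does its conjugate aσ; therefore σ does too. -/
theorem commute_base (h : IsSkewKantorFamily S K A s t) (hs : 1 < s) [Group.IsNilpotent G]
    (hconj : ∀ i, ∀ g ∈ K i, g ∉ S → ∃ x, x * g * x⁻¹ ∈ A i) {σ τ : G} (hσ : σ ∈ S)
    (hτ : τ ∈ S) : σ * τ = τ * σ := by
  have hN := h.normal_base
  have hne : Nonempty ι := by
    by_contra hn
    rw [not_nonempty_iff] at hn
    have := h.card_index
    rw [Nat.card_of_isEmpty] at this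
    omega
  obtain ⟨i⟩ := id hne
  rcases eq_or_lt_of_le (h.le_of_one_lt hs) with heq | hlt
  · rw [← commutatorElement_eq_one_iff_mul_comm]
    refine commute_of_conj_coset S (h.commutator_mem hne) ?_ ?_ σ τ hτ
    · intro g hg ρ hρ
      obtain ⟨k, hk⟩ := h.mem_tangent_of_card_eq hs heq.symm g hg
      obtain ⟨x, hx⟩ := hconj k g hk hg
      have hx1 : x * g * x⁻¹ ≠ 1 := fun h1 => hg (conj_eq_one_iff.mp h1 ▸ one_mem S)
      obtain ⟨y, hy⟩ := h.exists_conj_eq_mul hconj hx hx1 (hN.conj_mem ρ hρ x)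
      refine ⟨x⁻¹ * y * x, ?_⟩
      calc x⁻¹ * y * x * g * (x⁻¹ * y * x)⁻¹ = x⁻¹ * (y * (x * g * x⁻¹) * y⁻¹) * x := by group
        _ = g * ρ := by rw [hy]; group
    · have h1 := S.card_mul_index
      rw [h.card_group, h.card_base, heq] at h1
      rw [h.card_base, heq]
      exact (Nat.eq_of_mul_eq_mul_left h.pos.1 h1).ge
  · have h1 := h.le_card_centralizer hs hconj i
    have h2 : A i ⊓ Subgroup.centralizer (S : Set G) ≠ ⊥ := by
      rw [← Subgroup.one_lt_card_iff_ne_bot]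
      by_contra hle
      have : t * Nat.card ↥(A i ⊓ Subgroup.centralizer (S : Set G)) ≤ t * 1 :=
        Nat.mul_le_mul_left t (not_lt.mp hle)
      omega
    obtain ⟨a, ha, ha1⟩ := (Subgroup.bot_or_exists_ne_one _).resolve_left h2
    have haS := Subgroup.mem_centralizer_iff.mp ha.2
    obtain ⟨x, hx⟩ := h.exists_conj_eq_mul hconj ha.1 ha1 hσ
    have h3 := haS (x⁻¹ * τ * x) (by simpa using hN.conj_mem τ hτ x⁻¹)
    have h4 : τ * (a * σ) = (a * σ) * τ := by
      rw [← hx]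
      calc τ * (x * a * x⁻¹) = x * ((x⁻¹ * τ * x) * a) * x⁻¹ := by group
        _ = _ := by rw [h3]; group
    rw [← mul_assoc, haS τ hτ, mul_assoc, mul_assoc] at h4
    exact (mul_left_cancel h4).symm

end IsSkewKantorFamily

/-! ### Benson's congruence -/

/-- If `E` is idempotent and commutes with `Q`, where `Q ^ m = 1`, then the trace of `Q * E` is a
sum of roots of unity and zeros, hence an algebraic integer. -/
theorem Matrix.isIntegral_trace_mul_of_isIdempotentElem {n : Type*} [Fintype n] [DecidableEq n]
    {Q E : Matrix n n ℂ} (hQE : Commute Q E) (hE : E * E = E) {m : ℕ} (hm : 0 < m)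
    (hQ : Q ^ m = 1) : IsIntegral ℤ (Q * E).trace := by
  rw [Matrix.trace_eq_sum_roots_charpoly]
  refine IsIntegral.multiset_sum fun z hz => ?_
  have hroot : (Q * E).charpoly.IsRoot z := Polynomial.isRoot_of_mem_roots hz
  rw [← Matrix.mem_spectrum_iff_isRoot_charpoly] at hroot
  have hnt : Nontrivial (Matrix n n ℂ) := by
    by_contra hn
    rw [not_nontrivial_iff_subsingleton] at hn
    exact absurd hroot (by simp [spectrum.of_subsingleton])
  -- Eigenvalues are therefore roots of the monic polynomial X^(m+1) - X.
  have hX : (Q * E) ^ (m + 1) = Q * E := by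
    rw [hQE.mul_pow, pow_succ Q, hQ, one_mul, (show IsIdempotentElem E from hE).pow_succ_eq]
  have h1 := spectrum.subset_polynomial_aeval (Q * E)
    (Polynomial.X ^ (m + 1) - Polynomial.X : Polynomial ℂ) ⟨z, hroot, rfl⟩
  simp only [map_sub, map_pow, Polynomial.aeval_X, hX, sub_self, spectrum.zero_eq,
    Set.mem_singleton_iff, Polynomial.eval_sub, Polynomial.eval_pow, Polynomial.eval_X] at h1
  refine ⟨Polynomial.X ^ (m + 1) - Polynomial.X, ?_, by simpa using h1⟩
  exact Polynomial.monic_X_pow_sub (by rw [Polynomial.degree_X]; exact_mod_cast Nat.succ_lt_succ hm)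

namespace GenQuad

variable {P B : Type*} {s t : ℕ}

open Matrix

open scoped Classical in
/-- The incidence matrix. -/
noncomputable def incMatrix (Γ : GenQuad P B s t) : Matrix P B ℂ :=
  Matrix.of fun p L => if Γ.inc p L then 1 else 0

theorem proj_unique (Γ : GenQuad P B s t) {p q q' : P} {L M M' : B} (h : ¬ Γ.inc p L)
    (h1 : Γ.inc p M) (h2 : Γ.inc q M) (h3 : Γ.inc q L) (h1' : Γ.inc p M') (h2' : Γ.inc q' M')
    (h3' : Γ.inc q' L) : q = q' ∧ M = M' := by
  have := (Γ.existsUnique_proj p L h).unique (y₁ := (q, M)) (y₂ := (q', M')) ⟨h1, h2, h3⟩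
    ⟨h1', h2', h3'⟩
  exact ⟨congrArg Prod.fst this, congrArg Prod.snd this⟩

theorem exists_proj (Γ : GenQuad P B s t) {p : P} {L : B} (h : ¬ Γ.inc p L) :
    ∃ q M, Γ.inc p M ∧ Γ.inc q M ∧ Γ.inc q L := by
  obtain ⟨⟨q, M⟩, hqM, -⟩ := Γ.existsUnique_proj p L h
  exact ⟨q, M, hqM⟩

section Benson

variable [Fintype P] [Fintype B] (Γ : GenQuad P B s t)

omit [Fintype B] in
theorem sum_inc_points (L : B) : ∑ p, Γ.incMatrix p L = s + 1 := by
  classical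
  have := Γ.ncard_points L
  rw [Set.ncard_eq_toFinset_card'] at this
  simp only [incMatrix, Matrix.of_apply, Finset.sum_boole]
  rw [Set.toFinset_ofPred] at this
  rw [this]; push_cast; rfl

omit [Fintype P] in
theorem sum_inc_lines (p : P) : ∑ L, Γ.incMatrix p L = t + 1 := by
  classical
  have := Γ.ncard_lines p
  rw [Set.ncard_eq_toFinset_card'] at this
  simp only [incMatrix, Matrix.of_apply, Finset.sum_boole]
  rw [Set.toFinset_ofPred] at this
  rw [this]; push_cast; rfl

/-- The entry at (p, L) counts paths p, M, q, L. Off L the projection axiom leaves exactly one. On L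
only the paths with q = p or M = L occur, and inclusion–exclusion gives (t + 1) + (s + 1) - 1. -/
theorem incMatrix_mul_transpose_mul : Γ.incMatrix * Γ.incMatrixᵀ * Γ.incMatrix
    = ((s : ℂ) + t) • Γ.incMatrix + Matrix.of fun _ _ => 1 := by
  classical
  ext p L
  have h0 : (Γ.incMatrix * Γ.incMatrixᵀ * Γ.incMatrix) p L
      = ∑ x : P × B, Γ.incMatrix p x.2 * Γ.incMatrix x.1 x.2 * Γ.incMatrix x.1 L := by
    simp only [Matrix.mul_apply, Matrix.transpose_apply, Finset.sum_mul, Fintype.sum_prod_type]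
  rw [h0]
  simp only [Matrix.add_apply, Matrix.smul_apply, Matrix.of_apply, smul_eq_mul]
  by_cases hpL : Γ.inc p L
  · have h1 : ∀ x : P × B, Γ.incMatrix p x.2 * Γ.incMatrix x.1 x.2 * Γ.incMatrix x.1 L
        = (if x.1 = p then Γ.incMatrix p x.2 else 0)
          + (if x.2 = L then Γ.incMatrix x.1 L else 0)
          - (if x.1 = p then (if x.2 = L then 1 else 0) else 0) := by
      rintro ⟨q, M⟩
      by_cases hq : q = p
      · subst hq
        by_cases hM : M = L
        · subst hM; simp [incMatrix, hpL]
        · simp [incMatrix, hpL, hM]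
      · by_cases hM : M = L
        · subst hM; simp [incMatrix, hpL, hq]
        · simp only [hq, hM, if_false, add_zero, sub_zero]
          simp only [incMatrix, Matrix.of_apply]
          by_cases h1 : Γ.inc p M
          · by_cases h2 : Γ.inc q M
            · by_cases h3 : Γ.inc q L
              · exact absurd (Γ.eq_of_inc q p M L hq h2 h1 h3 hpL) hM
              · simp [h3]
            · simp [h2]
          · simp [h1]
    rw [Finset.sum_congr rfl fun x _ => h1 x, Finset.sum_sub_distrib, Finset.sum_add_distrib]
    simp only [Fintype.sum_prod_type]
    rw [Finset.sum_comm (f := fun q M => if M = L then Γ.incMatrix q L else 0)]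
    have e1 : ∑ q : P, ∑ M : B, (if q = p then Γ.incMatrix p M else 0) = (t : ℂ) + 1 := by
      rw [Finset.sum_comm]; simp [sum_inc_lines]
    have e2 : ∑ M : B, ∑ q : P, (if M = L then Γ.incMatrix q L else 0) = (s : ℂ) + 1 := by
      rw [Finset.sum_comm]; simp [sum_inc_points]
    rw [e1, e2]
    simp [incMatrix, hpL]
    ring
  · obtain ⟨⟨q₀, M₀⟩, ⟨a1, a2, a3⟩, hu⟩ := Γ.existsUnique_proj p L hpL
    rw [Finset.sum_eq_single (q₀, M₀)]
    · simp only at a1 a2 a3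
      simp [incMatrix, hpL, a1, a2, a3]
    · rintro ⟨q, M⟩ - hne
      simp only [incMatrix, Matrix.of_apply]
      by_cases h1 : Γ.inc p M
      · by_cases h2 : Γ.inc q M
        · by_cases h3 : Γ.inc q L
          · exact absurd (hu (q, M) ⟨h1, h2, h3⟩) hne
          · simp [h3]
        · simp [h2]
      · simp [h1]
    · intro h; exact absurd (Finset.mem_univ _) h

/-- Benson's congruence for an automorphism of a generalized quadrangle. -/
theorem benson [Nonempty P] (hst : 0 < s + t) (g : Equiv.Perm P × Equiv.Perm B) (hg : g ∈ Γ.Aut) :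
    ∃ z : ℤ, ((∑ L : B, {p | Γ.inc p L ∧ Γ.inc (g.1 p) L}.ncard : ℕ) : ℤ)
      = (s + 1) * (t + 1) + (s + t) * z := by
  classical
  set N := Γ.incMatrix with hN
  set M := N * Nᵀ with hM
  set J : Matrix P P ℂ := Matrix.of fun _ _ => 1 with hJ
  set n : ℂ := (Fintype.card P : ℂ) with hn
  set k : ℂ := ((s : ℂ) + 1) * (t + 1) with hk
  have hn0 : n ≠ 0 := by rw [hn]; exact_mod_cast Fintype.card_ne_zero
  have hst0 : (s : ℂ) + t ≠ 0 := by exact_mod_cast hst.ne'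
  have hJJ : J * J = n • J := by
    ext p q; simp [hJ, Matrix.mul_apply, hn]
  have hMsum : ∀ p, ∑ q, M p q = k := by
    intro p
    simp only [hM, Matrix.mul_apply, Matrix.transpose_apply]
    rw [Finset.sum_comm]
    simp only [← Finset.mul_sum, hN, sum_inc_points, ← Finset.sum_mul, sum_inc_lines]
    rw [hk]; ring
  have hMT : Mᵀ = M := by rw [hM, Matrix.transpose_mul, Matrix.transpose_transpose]
  have hMJ : M * J = k • J := by
    ext p q; simp [hJ, Matrix.mul_apply, hMsum]
  have hJM : J * M = k • J := by
    have := congrArg Matrix.transpose hMJ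
    rw [Matrix.transpose_mul, hMT, Matrix.transpose_smul] at this
    have hJT : Jᵀ = J := rfl
    rwa [hJT] at this
  have hMM : M * M = ((s : ℂ) + t) • M + ((t : ℂ) + 1) • J := by
    have h1 : (Matrix.of fun (_ : P) (_ : B) => (1 : ℂ)) * Nᵀ = ((t : ℂ) + 1) • J := by
      ext p q; simp [hJ, Matrix.mul_apply, hN, sum_inc_lines]
    calc M * M = (N * Nᵀ * N) * Nᵀ := by rw [hM]; simp only [Matrix.mul_assoc]
      _ = _ := by
        rw [hN, incMatrix_mul_transpose_mul, Matrix.add_mul, Matrix.smul_mul, ← hN, h1]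
  have hkk : k * k = (s + t) * k + (t + 1) * n := by
    have h1 : M * M * J = (k * k) • J := by
      rw [Matrix.mul_assoc, hMJ, Matrix.mul_smul, hMJ, smul_smul]
    rw [hMM, Matrix.add_mul, Matrix.smul_mul, Matrix.smul_mul, hMJ, hJJ, smul_smul,
      smul_smul] at h1
    obtain ⟨p⟩ := ‹Nonempty P›
    have h2 := congrFun (congrFun h1 p) p
    simpa [hJ] using h2.symm
  -- On constant vectors `M` acts as `k` and `J` as `n`, so subtracting `c • J` kills them and makes
  -- `E` the projection onto the eigenspace of `M` for s + t.
  set c : ℂ := k / n with hc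
  have hcn : c * n = k := by rw [hc]; field_simp
  have hck : c * k = (s + t) * c + (t + 1) := by
    rw [hc]; field_simp; linear_combination hkk
  set E : Matrix P P ℂ := ((s : ℂ) + t)⁻¹ • (M - c • J) with hE
  have hEE : E * E = E := by
    have h1 : (M - c • J) * (M - c • J) = ((s : ℂ) + t) • (M - c • J) := by
      simp only [Matrix.sub_mul, Matrix.mul_sub, Matrix.smul_mul, Matrix.mul_smul, hMM, hMJ, hJM,
        hJJ]
      ext p q
      simp only [Matrix.sub_apply, Matrix.add_apply, Matrix.smul_apply, smul_eq_mul, hJ,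
        Matrix.of_apply]
      linear_combination (-1 : ℂ) * hck + c * hcn
    rw [hE, Matrix.smul_mul, Matrix.mul_smul, h1, smul_smul, smul_smul]
    congr 1
    field_simp
  set Q : Matrix P P ℂ := g.1.permMatrix ℂ with hQ
  have hNg : ∀ p L, N (g.1 p) (g.2 L) = N p L := by
    intro p L
    simp only [hN, incMatrix, Matrix.of_apply, hg p L]
  have hMg : ∀ p q, M (g.1 p) (g.1 q) = M p q := by
    intro p q
    simp only [hM, Matrix.mul_apply, Matrix.transpose_apply]
    rw [← Equiv.sum_comp g.2]
    simp only [hNg]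
  have hQX : ∀ (X : Matrix P P ℂ) p q, (Q * X) p q = X (g.1 p) q := by
    intro X p q
    rw [hQ, Equiv.Perm.permMatrix, PEquiv.toMatrix_toPEquiv_mul]; rfl
  have hXQ : ∀ (X : Matrix P P ℂ) p q, (X * Q) p q = X p (g.1.symm q) := by
    intro X p q
    rw [hQ, Equiv.Perm.permMatrix, PEquiv.mul_toMatrix_toPEquiv]; rfl
  have hQE : Commute Q E := by
    ext p q
    rw [hQX, hXQ]
    simp only [hE, Matrix.smul_apply, Matrix.sub_apply, hJ, Matrix.of_apply]
    rw [← hMg p (g.1.symm q), Equiv.apply_symm_apply]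
  have hQpow : ∀ m : ℕ, Q ^ m = (g.1 ^ m).permMatrix ℂ := by
    intro m
    induction m with
    | zero => simp
    | succ m ih =>
      ext p q
      rw [pow_succ', hQX, ih]
      simp only [Equiv.Perm.permMatrix, PEquiv.toMatrix_apply, Equiv.toPEquiv_apply, pow_succ,
        Equiv.Perm.mul_apply]
      congr
  have hQm : Q ^ orderOf g.1 = 1 := by rw [hQpow, pow_orderOf_eq_one]; simp
  have hint := Matrix.isIntegral_trace_mul_of_isIdempotentElem hQE hEE (orderOf_pos g.1) hQm
  -- The trace of `Q * M` counts the pairs (p, L) with p and its image both on L; the `J` term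
  -- contributes c * n = k.
  have htr : (Q * E).trace = ((s : ℂ) + t)⁻¹ *
      (((∑ L : B, {p | Γ.inc p L ∧ Γ.inc (g.1 p) L}.ncard : ℕ) : ℂ) - k) := by
    simp only [Matrix.trace, Matrix.diag, hQX, hE, Matrix.smul_apply, smul_eq_mul]
    rw [← Finset.mul_sum]
    congr 1
    simp only [Matrix.sub_apply, Finset.sum_sub_distrib, Matrix.smul_apply, hJ, Matrix.of_apply]
    congr 1
    · simp only [hM, Matrix.mul_apply, Matrix.transpose_apply]
      rw [Finset.sum_comm]
      push_cast
      refine Finset.sum_congr rfl fun L _ => ?_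
      rw [Set.ncard_eq_toFinset_card', Set.toFinset_ofPred, Finset.card_eq_sum_ones,
        Finset.sum_filter]
      push_cast
      refine Finset.sum_congr rfl fun p _ => ?_
      simp only [hN, incMatrix, Matrix.of_apply]
      by_cases h1 : Γ.inc p L <;> by_cases h2 : Γ.inc (g.1 p) L <;> simp [h1, h2]
    · simp only [smul_eq_mul, mul_one, Finset.sum_const, Finset.card_univ, nsmul_eq_mul]
      rw [mul_comm, ← hcn]
  set T : ℕ := ∑ L : B, {p | Γ.inc p L ∧ Γ.inc (g.1 p) L}.ncard with hT
  set r : ℚ := ((s : ℚ) + t)⁻¹ * ((T : ℚ) - (s + 1) * (t + 1)) with hr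
  have hr' : (Q * E).trace = algebraMap ℚ ℂ r := by
    rw [htr, hr, hk]; simp
  -- A rational algebraic integer is an integer, and this integer is the required z.
  rw [hr', isIntegral_algebraMap_iff (algebraMap ℚ ℂ).injective,
    IsIntegrallyClosed.isIntegral_iff] at hint
  obtain ⟨z, hz⟩ := hint
  refine ⟨z, ?_⟩
  have hst1 : (s : ℚ) + t ≠ 0 := by exact_mod_cast hst.ne'
  have h1 : (z : ℚ) = ((s : ℚ) + t)⁻¹ * ((T : ℚ) - (s + 1) * (t + 1)) := by
    rw [← hr, ← hz]; simp
  have h2 : (T : ℚ) = (s + 1) * (t + 1) + (s + t) * z := by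
    rw [h1]; field_simp; ring
  exact_mod_cast h2

end Benson

end GenQuad

/-! ### Orbit counting and arithmetic -/

/-- If a map on the subgroup `K` has the left cosets of `A` as fibres, then `|K|` is `|A|` times
the size of the image. -/
theorem Subgroup.card_eq_mul_ncard_of_fibers {G X : Type*} [Group G] (K A : Subgroup G)
    (hAK : A ≤ K) (f : G → X) (Y : Set X) (hmaps : ∀ g ∈ K, f g ∈ Y)
    (hsurj : ∀ y ∈ Y, ∃ g ∈ K, f g = y)
    (hf : ∀ g ∈ K, ∀ h ∈ K, f g = f h ↔ g⁻¹ * h ∈ A) : Nat.card K = Nat.card A * Y.ncard := by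
  rw [Subgroup.card_eq_card_quotient_mul_card_subgroup (A.subgroupOf K),
    Nat.card_congr (Subgroup.subgroupOfEquivOfLe hAK).toEquiv, mul_comm]
  congr 1
  let F : (K ⧸ A.subgroupOf K) → Y := Quotient.lift (fun g : K => ⟨f g, hmaps g g.2⟩) (by
    intro a b hab
    exact Subtype.ext ((hf a a.2 b b.2).mpr
      (Subgroup.mem_subgroupOf.mp (QuotientGroup.leftRel_apply.mp hab))))
  refine Nat.card_eq_of_bijective F ⟨?_, ?_⟩
  · intro a b
    refine Quotient.inductionOn₂ a b fun a b hab => Quotient.sound ?_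
    exact QuotientGroup.leftRel_apply.mpr (Subgroup.mem_subgroupOf.mpr
      ((hf a a.2 b b.2).mp (congrArg Subtype.val hab)))
  · rintro ⟨y, hy⟩
    obtain ⟨g, hg, hgy⟩ := hsurj y hy
    exact ⟨QuotientGroup.mk ⟨g, hg⟩, Subtype.ext hgy⟩

/-- Divisibility of st gives divisibility of s², so s + t is a power of p with s < s + t ≤ 2s. This
forces p = 2 and s = t, with s even. -/
theorem not_add_dvd_mul_of_prime_pow {p n s t : ℕ} (hp : p.Prime) (hn : s = p ^ n) (hs : 1 < s)
    (ht : 0 < t) (hts : t ≤ s) (hpar : Even s → s ≠ t) : ¬ s + t ∣ s * t := by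
  intro h
  have h1 : s + t ∣ s * s := by
    have : s + t ∣ s * t + s * s := by rw [← mul_add, add_comm t]; exact dvd_mul_left _ _
    exact (Nat.dvd_add_right h).mp this
  rw [hn, ← pow_add, ← hn] at h1
  obtain ⟨m, -, hm⟩ := (Nat.dvd_prime_pow hp).mp h1
  have hnm : n < m := by
    by_contra hle
    have := Nat.pow_le_pow_right hp.pos (not_lt.mp hle)
    omega
  obtain ⟨k, rfl⟩ := Nat.exists_eq_add_of_lt hnm
  have h2 : p ^ (n + k + 1) = s * p ^ (k + 1) := by rw [hn, ← pow_add, add_assoc]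
  have h3 : p ^ (k + 1) ≤ 2 := by
    refine Nat.le_of_mul_le_mul_left ?_ (by omega : 0 < s)
    rw [← h2, ← hm]; omega
  have h4 : p ≤ p ^ (k + 1) := Nat.le_self_pow (by omega) p
  have h5 := hp.two_le
  have hp2 : p = 2 := by omega
  have h6 : p ^ (k + 1) = 2 := by omega
  rw [h2, h6] at hm
  refine hpar ?_ (by omega)
  have hn0 : n ≠ 0 := by rintro rfl; rw [pow_zero] at hn; omega
  rw [hn, hp2]
  exact Nat.even_pow.mpr ⟨even_two, hn0⟩

/-! ### From the quadrangle to the Kantor family -/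

namespace GenQuad

variable {P B : Type*} {s t : ℕ} {Γ : GenQuad P B s t} {x : P}
  {H : Subgroup (Equiv.Perm P × Equiv.Perm B)}

theorem not_collinear_of_ne {p u : P} {L M : B} (hxL : ¬ Γ.inc x L) (hxM : Γ.inc x M)
    (huM : Γ.inc u M) (huL : Γ.inc u L) (hpL : Γ.inc p L) (hpu : p ≠ u) :
    ¬ Γ.Collinear x p := by
  rintro ⟨N, hxN, hpN⟩
  exact hpu (Γ.proj_unique hxL hxN hpN hpL hxM huM huL).1

theorem exists_point_ne (Γ : GenQuad P B s t) (hs : 0 < s) (L : B) (u : P) :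
    ∃ p, Γ.inc p L ∧ p ≠ u := by
  have h1 : 1 < {p : P | Γ.inc p L}.ncard := by rw [Γ.ncard_points]; omega
  exact Set.exists_ne_of_one_lt_ncard h1 u

theorem exists_line_ne (Γ : GenQuad P B s t) (ht : 0 < t) (p : P) (M : B) :
    ∃ L, Γ.inc p L ∧ L ≠ M := by
  have h1 : 1 < {L : B | Γ.inc p L}.ncard := by rw [Γ.ncard_lines]; omega
  exact Set.exists_ne_of_one_lt_ncard h1 M

theorem exists_affine_line (Γ : GenQuad P B s t) (hs : 0 < s) (ht : 0 < t) {x : P} {M : B}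
    (hxM : Γ.inc x M) : ∃ u L, ¬ Γ.inc x L ∧ Γ.inc u M ∧ Γ.inc u L := by
  obtain ⟨u, huM, hux⟩ := Γ.exists_point_ne hs M x
  obtain ⟨L, huL, hLM⟩ := Γ.exists_line_ne ht u M
  exact ⟨u, L, fun hxL => hLM (Γ.eq_of_inc u x L M hux huL hxL huM hxM), huM, huL⟩

namespace IsEGQ

theorem inc_iff (hE : Γ.IsEGQ x H) {g : Equiv.Perm P × Equiv.Perm B} (hg : g ∈ H) (p : P) (L : B) :
    Γ.inc (g.1 p) (g.2 L) ↔ Γ.inc p L :=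
  hE.le_aut hg p L

theorem inc_map (hE : Γ.IsEGQ x H) {g : Equiv.Perm P × Equiv.Perm B} (hg : g ∈ H) {p : P} {M : B}
    (hxM : Γ.inc x M) : Γ.inc (g.1 p) M ↔ Γ.inc p M := by
  conv_lhs => rw [← hE.linewise g hg M hxM]
  exact hE.inc_iff hg p M

theorem eq_one (hE : Γ.IsEGQ x H) {g : Equiv.Perm P × Equiv.Perm B} (hg : g ∈ H) {p : P}
    (hp : ¬ Γ.Collinear x p) (hgp : g.1 p = p) : g = 1 :=
  (hE.sharplyTransitive p p hp hp).unique ⟨hg, hgp⟩ ⟨H.one_mem, rfl⟩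

theorem apply_center (hE : Γ.IsEGQ x H) (ht : 0 < t) {g : Equiv.Perm P × Equiv.Perm B}
    (hg : g ∈ H) : g.1 x = x := by
  by_contra hne
  have h1 : 1 < {L : B | Γ.inc x L}.ncard := by rw [Γ.ncard_lines]; omega
  obtain ⟨M, hM, M', hM', hMM'⟩ := (Set.one_lt_ncard_iff_nontrivial_and_finite.mp h1).1
  exact hMM' (Γ.eq_of_inc (g.1 x) x M M' hne ((hE.inc_map hg hM).mpr hM) hM
    ((hE.inc_map hg hM').mpr hM') hM')

/-- An element of `H` maps the projection of `p` on a line `M` through `x` to the projection of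
the image of `p`. -/
theorem map_proj (hE : Γ.IsEGQ x H) {g : Equiv.Perm P × Equiv.Perm B} (hg : g ∈ H) {p v v' : P}
    {M N N' : B} (hxM : Γ.inc x M) (hpM : ¬ Γ.inc p M) (hpN : Γ.inc p N) (hvN : Γ.inc v N)
    (hvM : Γ.inc v M) (hpN' : Γ.inc (g.1 p) N') (hvN' : Γ.inc v' N') (hvM' : Γ.inc v' M) :
    g.1 v = v' ∧ g.2 N = N' :=
  Γ.proj_unique (fun h => hpM ((hE.inc_map hg hxM).mp h)) ((hE.inc_iff hg p N).mpr hpN)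
    ((hE.inc_iff hg v N).mpr hvN) ((hE.inc_map hg hxM).mpr hvM) hpN' hvN' hvM'

/-- `H` is transitive on the affine lines meeting a given line through `x`. -/
theorem exists_map_line (hE : Γ.IsEGQ x H) (hs : 0 < s) {u v : P} {L N M : B} (hxM : Γ.inc x M)
    (hxL : ¬ Γ.inc x L) (huM : Γ.inc u M) (huL : Γ.inc u L) (hxN : ¬ Γ.inc x N)
    (hvM : Γ.inc v M) (hvN : Γ.inc v N) : ∃ g ∈ H, g.2 L = N ∧ g.1 u = v := by
  obtain ⟨p, hpL, hpu⟩ := Γ.exists_point_ne hs L u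
  obtain ⟨q, hqN, hqv⟩ := Γ.exists_point_ne hs N v
  have hp := not_collinear_of_ne hxL hxM huM huL hpL hpu
  have hq := not_collinear_of_ne hxN hxM hvM hvN hqN hqv
  obtain ⟨g, ⟨hg, hgp⟩, -⟩ := hE.sharplyTransitive p q hp hq
  have := hE.map_proj hg hxM (fun h => hp ⟨M, hxM, h⟩) hpL huL huM (hgp ▸ hqN) hvN hvM
  exact ⟨g, hg, this.2, this.1⟩

theorem apply_eq_of_line_fixed (hE : Γ.IsEGQ x H) {g : Equiv.Perm P × Equiv.Perm B} (hg : g ∈ H)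
    {u : P} {L M : B} (hxM : Γ.inc x M) (hxL : ¬ Γ.inc x L) (huM : Γ.inc u M) (huL : Γ.inc u L)
    (hgL : g.2 L = L) : g.1 u = u := by
  by_contra hne
  have h1 : Γ.inc (g.1 u) L := hgL ▸ (hE.inc_iff hg u L).mpr huL
  have := Γ.eq_of_inc (g.1 u) u L M hne h1 huL ((hE.inc_map hg hxM).mpr huM) huM
  exact hxL (this ▸ hxM)

/-- An element of `H` fixing a line `M` through `x` pointwise and an affine line that does not
meet `M` is trivial. -/
theorem eq_one_of_line_fixed (hE : Γ.IsEGQ x H) (hs : 0 < s)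
    {g : Equiv.Perm P × Equiv.Perm B} (hg : g ∈ H) {u : P} {L M M' : B} (hMM' : M ≠ M')
    (hxM : Γ.inc x M) (hxM' : Γ.inc x M') (hxL : ¬ Γ.inc x L) (huM' : Γ.inc u M')
    (huL : Γ.inc u L) (hgM : Γ.FixesPointwise M g) (hgL : g.2 L = L) : g = 1 := by
  obtain ⟨p, hpL, hpu⟩ := Γ.exists_point_ne hs L u
  have hp := not_collinear_of_ne hxL hxM' huM' huL hpL hpu
  -- The projection v of p on `M` is fixed, and p is in turn the projection of v on the fixed line
  -- `L`, so p is fixed.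
  obtain ⟨v, N, hpN, hvN, hvM⟩ := Γ.exists_proj (fun h : Γ.inc p M => hp ⟨M, hxM, h⟩)
  have hvL : ¬ Γ.inc v L := by
    intro hvL
    have hvu : v = u := by
      by_contra hne
      exact not_collinear_of_ne hxL hxM' huM' huL hvL hne ⟨M, hxM, hvM⟩
    subst hvu
    exact hMM' (Γ.eq_of_inc v x M M' (fun h => hxL (h ▸ hvL)) hvM hxM huM' hxM')
  have h1 : Γ.inc v (g.2 N) := by
    have := (hE.inc_iff hg v N).mpr hvN
    rwa [hgM v hvM] at this
  refine hE.eq_one hg hp ?_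
  exact (Γ.proj_unique hvL h1 ((hE.inc_iff hg p N).mpr hpN)
    (hgL ▸ (hE.inc_iff hg p L).mpr hpL) hvN hpN hpL).1

end IsEGQ

/-- The subgroup of the elements of `H` which fix every point of the line `M`. -/
def pointwiseStabilizer (Γ : GenQuad P B s t) (H : Subgroup (Equiv.Perm P × Equiv.Perm B)) (M : B) :
    Subgroup H where
  carrier := {g | Γ.FixesPointwise M g.1}
  one_mem' := fun _ _ => rfl
  mul_mem' := by
    intro g h hg hh p hp
    simp [hh p hp, hg p hp]
  inv_mem' := by
    intro g hg p hp
    exact Equiv.Perm.inv_eq_iff_eq.mpr (hg p hp).symm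

theorem mem_lineStabilizer_subgroupOf {L : B} {g : H} :
    g ∈ (lineStabilizer H L).subgroupOf H ↔ g.1.2 L = L :=
  ⟨fun h => h.2, fun h => ⟨g.2, h⟩⟩

/-- The stabilizer acts regularly on the s points of `L` other than u. -/
theorem card_lineStabilizer (hE : Γ.IsEGQ x H) (hs : 0 < s) {u : P} {L M : B} (hxM : Γ.inc x M)
    (hxL : ¬ Γ.inc x L) (huM : Γ.inc u M) (huL : Γ.inc u L) :
    Nat.card ((lineStabilizer H L).subgroupOf H) = s := by
  obtain ⟨p, hpL, hpu⟩ := Γ.exists_point_ne hs L u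
  have hp := not_collinear_of_ne hxL hxM huM huL hpL hpu
  rw [Subgroup.card_eq_mul_ncard_of_fibers _ ⊥ bot_le (fun g : H => g.1.1 p)
    ({q | Γ.inc q L} \ {u})]
  · rw [Set.ncard_sdiff_singleton_of_mem (show u ∈ {q | Γ.inc q L} from huL), Γ.ncard_points]
    simp
  · intro g hg
    rw [mem_lineStabilizer_subgroupOf] at hg
    refine ⟨?_, ?_⟩
    · have := (hE.inc_iff g.2 p L).mpr hpL
      rwa [hg] at this
    · intro h
      have h1 := hE.apply_eq_of_line_fixed g.2 hxM hxL huM huL hg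
      exact hpu (g.1.1.injective ((Set.mem_singleton_iff.mp h).trans h1.symm))
  · rintro q ⟨hqL, hqu⟩
    have hq := not_collinear_of_ne hxL hxM huM huL hqL hqu
    obtain ⟨g, ⟨hg, hgp⟩, -⟩ := hE.sharplyTransitive p q hp hq
    exact ⟨⟨g, hg⟩, mem_lineStabilizer_subgroupOf.mpr
      (hE.map_proj hg hxM (fun h => hp ⟨M, hxM, h⟩) hpL huL huM (hgp ▸ hqL) huL huM).2, hgp⟩
  · intro g _ h _
    rw [Subgroup.mem_bot]
    constructor
    · intro hgh
      refine Subtype.ext (hE.eq_one (g⁻¹ * h).2 hp ?_)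
      simp only [Subgroup.coe_mul, Subgroup.coe_inv, Prod.fst_mul, Prod.fst_inv,
        Equiv.Perm.mul_apply]
      rw [← hgh]
      simp
    · intro hgh
      rw [inv_mul_eq_one.mp hgh]

theorem lineStabilizer_le (hE : Γ.IsEGQ x H) (hstar : Γ.HasStar x H) {u : P} {L M : B}
    (hxM : Γ.inc x M) (hxL : ¬ Γ.inc x L) (huM : Γ.inc u M) (huL : Γ.inc u L) :
    (lineStabilizer H L).subgroupOf H ≤ Γ.pointwiseStabilizer H M := by
  intro g hg
  have h1 := hE.apply_eq_of_line_fixed g.2 hxM hxL huM huL (mem_lineStabilizer_subgroupOf.mp hg)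
  exact hstar g.1 g.2 u M (fun h => hxL (h ▸ huL)) hxM huM h1

/-- By (*) this group is the stabilizer of u, transitive on the t lines on u other than `M`, and the
stabilizer of `L` has order s. -/
theorem card_pointwiseStabilizer (hE : Γ.IsEGQ x H) (hstar : Γ.HasStar x H) (hs : 0 < s) {u : P}
    {L M : B} (hxM : Γ.inc x M) (hxL : ¬ Γ.inc x L) (huM : Γ.inc u M) (huL : Γ.inc u L) :
    Nat.card (Γ.pointwiseStabilizer H M) = s * t := by
  have hux : u ≠ x := fun h => hxL (h ▸ huL)
  rw [Subgroup.card_eq_mul_ncard_of_fibers _ ((lineStabilizer H L).subgroupOf H)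
    (lineStabilizer_le hE hstar hxM hxL huM huL) (fun g : H => g.1.2 L) ({N | Γ.inc u N} \ {M}),
    card_lineStabilizer hE hs hxM hxL huM huL]
  · rw [Set.ncard_sdiff_singleton_of_mem (show M ∈ {N | Γ.inc u N} from huM), Γ.ncard_lines]
    simp
  · intro g hg
    refine ⟨?_, ?_⟩
    · have := (hE.inc_iff g.2 u L).mpr huL
      rwa [hg u huM] at this
    · intro h
      have h1 := hE.linewise g.1 g.2 M hxM
      have h2 : L = M := g.1.2.injective ((Set.mem_singleton_iff.mp h).trans h1.symm)
      exact hxL (h2 ▸ hxM)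
  · rintro N ⟨huN, hNM⟩
    have hxN : ¬ Γ.inc x N := fun hxN => hNM (Γ.eq_of_inc u x N M hux huN hxN huM hxM)
    obtain ⟨g, hg, hgL, hgu⟩ := hE.exists_map_line hs hxM hxL huM huL hxN huM huN
    exact ⟨⟨g, hg⟩, hstar g hg u M hux hxM huM hgu, hgL⟩
  · intro g _ h _
    rw [mem_lineStabilizer_subgroupOf]
    simp only [Subgroup.coe_mul, Subgroup.coe_inv, Prod.snd_mul, Prod.snd_inv,
      Equiv.Perm.mul_apply]
    rw [Equiv.Perm.inv_eq_iff_eq, eq_comm]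

theorem card_eq_mul_card_pointwiseStabilizer (hE : Γ.IsEGQ x H) (hstar : Γ.HasStar x H)
    (hs : 0 < s) (ht : 0 < t) {M : B} (hxM : Γ.inc x M) :
    Nat.card H = Nat.card (Γ.pointwiseStabilizer H M) * s := by
  obtain ⟨u, L, hxL, huM, huL⟩ := Γ.exists_affine_line hs ht hxM
  have hux : u ≠ x := fun h => hxL (h ▸ huL)
  rw [← Subgroup.card_top, Subgroup.card_eq_mul_ncard_of_fibers ⊤ (Γ.pointwiseStabilizer H M)
    le_top (fun g : H => g.1.1 u) ({v | Γ.inc v M} \ {x})]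
  · rw [Set.ncard_sdiff_singleton_of_mem (show x ∈ {v | Γ.inc v M} from hxM), Γ.ncard_points]
    simp
  · intro g _
    refine ⟨(hE.inc_map g.2 hxM).mpr huM, fun h => hux (g.1.1.injective ?_)⟩
    rw [hE.apply_center ht g.2]
    exact h
  · rintro v ⟨hvM, hvx⟩
    obtain ⟨N, hvN, hNM⟩ := Γ.exists_line_ne ht v M
    have hxN : ¬ Γ.inc x N := fun hxN => hNM (Γ.eq_of_inc v x N M hvx hvN hxN hvM hxM)
    obtain ⟨g, hg, -, hgu⟩ := hE.exists_map_line hs hxM hxL huM huL hxN hvM hvN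
    exact ⟨⟨g, hg⟩, Subgroup.mem_top _, hgu⟩
  · intro g _ h _
    have h1 : g⁻¹ * h ∈ Γ.pointwiseStabilizer H M ↔ (g⁻¹ * h).1.1 u = u :=
      ⟨fun h => h u huM, fun h => hstar _ (g⁻¹ * _).2 u M hux hxM huM h⟩
    rw [h1]
    simp only [Subgroup.coe_mul, Subgroup.coe_inv, Prod.fst_mul, Prod.fst_inv,
      Equiv.Perm.mul_apply]
    rw [Equiv.Perm.inv_eq_iff_eq, eq_comm]

theorem normal_pointwiseStabilizer (hE : Γ.IsEGQ x H) {M : B} (hxM : Γ.inc x M) :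
    (Γ.pointwiseStabilizer H M).Normal := by
  constructor
  intro g hg h p hp
  have h1 : Γ.inc ((h⁻¹).1.1 p) M := (hE.inc_map (h⁻¹).2 hxM).mpr hp
  have h2 := hg _ h1
  simp only [Subgroup.coe_mul, Prod.fst_mul, Equiv.Perm.mul_apply]
  rw [h2]
  simp

/-- The stabilizers of affine lines, one for each line through `x`, form a skew translation
Kantor family. -/
theorem isSkewKantorFamily [Finite P] [Finite B] (hST : Γ.IsSTGQ x H) (hstar : Γ.HasStar x H) (hs : 0 < s) (ht : 0 < t)
    (hab : ∀ L : B, ¬ Γ.inc x L → ∀ a ∈ lineStabilizer H L, ∀ b ∈ lineStabilizer H L,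
      a * b = b * a)
    (u : {M // Γ.inc x M} → P) (ℓ : {M // Γ.inc x M} → B) (hxℓ : ∀ M, ¬ Γ.inc x (ℓ M))
    (huM : ∀ M, Γ.inc (u M) M.1) (huℓ : ∀ M, Γ.inc (u M) (ℓ M)) :
    IsSkewKantorFamily ((Γ.symmetryGroup x H).subgroupOf H)
      (fun M : {M // Γ.inc x M} => Γ.pointwiseStabilizer H M.1)
      (fun M => (lineStabilizer H (ℓ M)).subgroupOf H) s t := by
  have hE := hST.toIsEGQ
  have cK : ∀ M : {M // Γ.inc x M}, Nat.card (Γ.pointwiseStabilizer H M.1) = s * t := fun M =>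
    card_pointwiseStabilizer hE hstar hs M.2 (hxℓ M) (huM M) (huℓ M)
  have cA : ∀ M : {M // Γ.inc x M}, Nat.card ((lineStabilizer H (ℓ M)).subgroupOf H) = s :=
    fun M => card_lineStabilizer hE hs M.2 (hxℓ M) (huM M) (huℓ M)
  have hle : ∀ M : {M // Γ.inc x M},
      (lineStabilizer H (ℓ M)).subgroupOf H ≤ Γ.pointwiseStabilizer H M.1 := fun M =>
    lineStabilizer_le hE hstar M.2 (hxℓ M) (huM M) (huℓ M)
  have hcard : Nat.card {M // Γ.inc x M} = t + 1 := Γ.ncard_lines x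
  obtain ⟨M₁, M₂, hM₁₂⟩ : ∃ M₁ M₂ : {M // Γ.inc x M}, M₁ ≠ M₂ := by
    have : Nontrivial {M // Γ.inc x M} :=
      Finite.one_lt_card_iff_nontrivial.mp (by rw [hcard]; omega)
    exact exists_pair_ne _
  have cH : Nat.card H = s * (s * t) := by
    rw [card_eq_mul_card_pointwiseStabilizer hE hstar hs ht M₁.2, cK M₁, Nat.mul_comm]
  have hdisj : ∀ M M' : {M // Γ.inc x M}, M ≠ M' → Disjoint (Γ.pointwiseStabilizer H M.1)
      ((lineStabilizer H (ℓ M')).subgroupOf H) := by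
    intro M M' hne
    rw [Subgroup.disjoint_def]
    intro g hg hg'
    exact Subtype.ext (hE.eq_one_of_line_fixed hs g.2 (fun h => hne (Subtype.ext h)) M.2 M'.2
      (hxℓ M') (huM M') (huℓ M') hg (mem_lineStabilizer_subgroupOf.mp hg'))
  -- K_M' contains the complement A_M' of K_M, so it maps onto H / K_M, which has order s; the
  -- kernel has order st / s = t.
  have hinf : ∀ M M' : {M // Γ.inc x M}, M ≠ M' →
      Nat.card ↥(Γ.pointwiseStabilizer H M.1 ⊓ Γ.pointwiseStabilizer H M'.1) = t := by
    intro M M' hne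
    have hn := normal_pointwiseStabilizer hE M.2
    have hcompl : (Γ.pointwiseStabilizer H M.1).IsComplement'
        ((lineStabilizer H (ℓ M')).subgroupOf H) :=
      Subgroup.isComplement'_of_card_mul_and_disjoint (by rw [cK, cA, cH]; ring) (hdisj M M' hne)
    have h1 := Subgroup.card_eq_mul_ncard_of_fibers (Γ.pointwiseStabilizer H M'.1)
      (Γ.pointwiseStabilizer H M.1 ⊓ Γ.pointwiseStabilizer H M'.1) inf_le_right
      (QuotientGroup.mk' (Γ.pointwiseStabilizer H M.1)) Set.univ (fun _ _ => Set.mem_univ _) ?_ ?_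
    · have h2 := (Γ.pointwiseStabilizer H M.1).card_mul_index
      rw [cK, cH] at h2
      have h3 : (Γ.pointwiseStabilizer H M.1).index = s := by
        refine Nat.eq_of_mul_eq_mul_left (Nat.mul_pos hs ht) ?_
        rw [h2]; ring
      rw [Set.ncard_univ, cK] at h1
      have h4 : Nat.card (H ⧸ Γ.pointwiseStabilizer H M.1) = s := h3
      rw [h4, Nat.mul_comm] at h1
      exact (Nat.eq_of_mul_eq_mul_right hs h1).symm
    · intro y _
      obtain ⟨g, rfl⟩ := QuotientGroup.mk'_surjective _ y
      obtain ⟨⟨k, a⟩, hka⟩ := hcompl.2 g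
      refine ⟨a, hle M' a.2, ?_⟩
      rw [← hka, map_mul, (QuotientGroup.eq_one_iff (k : H)).mpr k.2 |> fun h =>
        (show QuotientGroup.mk' (Γ.pointwiseStabilizer H M.1) (k : H) = 1 from h), one_mul]
    · intro g hg h hh
      rw [QuotientGroup.mk'_apply, QuotientGroup.mk'_apply, QuotientGroup.eq]
      exact ⟨fun h1 => ⟨h1, Subgroup.mul_mem _ (Subgroup.inv_mem _ hg) hh⟩, fun h1 => h1.1⟩
  obtain ⟨S₀, hS₀, cS₀⟩ := hST.exists_symmetries
  have hS₀H : S₀ ≤ H := hS₀.trans inf_le_left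
  have ht_le : t ≤ Nat.card ((Γ.symmetryGroup x H).subgroupOf H) := by
    calc t = Nat.card (S₀.subgroupOf H) := by
          rw [Nat.card_congr (Subgroup.subgroupOfEquivOfLe hS₀H).toEquiv, cS₀]
      _ ≤ _ := Subgroup.card_le_of_le (Subgroup.comap_mono hS₀)
  have hS_le : ∀ M : {M // Γ.inc x M},
      (Γ.symmetryGroup x H).subgroupOf H ≤ Γ.pointwiseStabilizer H M.1 := by
    intro M g hg p hp
    exact hg.2.2.2 p ⟨M.1, M.2, hp⟩
  have hS_eq : ∀ M M' : {M // Γ.inc x M}, M ≠ M' →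
      Γ.pointwiseStabilizer H M.1 ⊓ Γ.pointwiseStabilizer H M'.1
        = (Γ.symmetryGroup x H).subgroupOf H := by
    intro M M' hne
    refine (Subgroup.eq_of_le_of_card_ge (le_inf (hS_le M) (hS_le M')) ?_).symm
    rw [hinf M M' hne]
    exact ht_le
  have hn₁ := normal_pointwiseStabilizer hE M₁.2
  have hn₂ := normal_pointwiseStabilizer hE M₂.2
  exact
  { normal_base := by
      rw [← hS_eq M₁ M₂ hM₁₂]
      infer_instance
    normal := fun M => normal_pointwiseStabilizer hE M.2
    card_base := by rw [← hS_eq M₁ M₂ hM₁₂, hinf M₁ M₂ hM₁₂]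
    card_A := cA
    card_K := cK
    card_group := cH
    le := hle
    inf_eq := hS_eq
    disjoint := hdisj
    mul_comm := fun M a ha b hb => Subtype.ext (hab _ (hxℓ M) a.1 ha b.1 hb)
    card_index := hcard }

/-- If `s + t` does not divide `s * t`, then every element of `H` which fixes a line `M` through `x`
pointwise but is not a symmetry fixes some affine line meeting `M`. -/
theorem exists_fixed_affine_line [Finite P] [Finite B] (hE : Γ.IsEGQ x H) (hstar : Γ.HasStar x H) (hs : 0 < s)
    (ht : 0 < t) (hdvd : ¬ s + t ∣ s * t) (hcard : Nat.card H = s * (s * t)) {M : B}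
    (hxM : Γ.inc x M)
    {g : H} (hgM : g ∈ Γ.pointwiseStabilizer H M)
    (hgS : ∀ M', Γ.inc x M' → M' ≠ M → g ∉ Γ.pointwiseStabilizer H M') :
    ∃ N v, ¬ Γ.inc x N ∧ Γ.inc v M ∧ Γ.inc v N ∧ g.1.2 N = N := by
  classical
  by_contra hno
  push Not at hno
  have := Fintype.ofFinite P
  have := Fintype.ofFinite B
  have : Nonempty P := ⟨x⟩
  apply hdvd
  obtain ⟨u, L, hxL, huM, huL⟩ := Γ.exists_affine_line hs ht hxM
  set Y : Set B := {N | ¬ Γ.inc x N ∧ ∃ v, Γ.inc v M ∧ Γ.inc v N} with hY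
  have hYcard : Y.ncard = s * t := by
    have h1 := Subgroup.card_eq_mul_ncard_of_fibers ⊤ ((lineStabilizer H L).subgroupOf H) le_top
      (fun g : H => g.1.2 L) Y ?_ ?_ ?_
    · rw [Subgroup.card_top, card_lineStabilizer hE hs hxM hxL huM huL, hcard] at h1
      exact (Nat.eq_of_mul_eq_mul_left hs h1).symm
    · intro h _
      refine ⟨fun hx => hxL ?_, h.1.1 u, (hE.inc_map h.2 hxM).mpr huM,
        (hE.inc_iff h.2 u L).mpr huL⟩
      rwa [← hE.inc_iff h.2, hE.apply_center ht h.2]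
    · rintro N ⟨hxN, v, hvM, hvN⟩
      obtain ⟨h, hh, hhL, -⟩ := hE.exists_map_line hs hxM hxL huM huL hxN hvM hvN
      exact ⟨⟨h, hh⟩, Subgroup.mem_top _, hhL⟩
    · intro h _ h' _
      rw [mem_lineStabilizer_subgroupOf]
      simp only [Subgroup.coe_mul, Subgroup.coe_inv, Prod.snd_mul, Prod.snd_inv,
        Equiv.Perm.mul_apply]
      rw [Equiv.Perm.inv_eq_iff_eq, eq_comm]
  -- An affine line meeting `M` contributes only its point on `M`. On any other affine line, a point
  -- and its image both on it would make g fix the projection of x, and by (*) a second line through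
  -- x pointwise, against `hgS`.
  have hterm : ∀ N : B, {p | Γ.inc p N ∧ Γ.inc (g.1.1 p) N}.ncard
      = (if N ∈ {N | Γ.inc x N} then s + 1 else 0) + (if N ∈ Y then 1 else 0) := by
    intro N
    by_cases hxN : Γ.inc x N
    · have h1 : {p | Γ.inc p N ∧ Γ.inc (g.1.1 p) N} = {p | Γ.inc p N} := by
        ext p
        simp only [Set.mem_ofPred_eq, hE.inc_map g.2 hxN, and_self]
      rw [h1, Γ.ncard_points]
      simp [hY, hxN]
    · simp only [Set.mem_ofPred_eq, hxN, if_false, zero_add]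
      by_cases hNY : N ∈ Y
      · obtain ⟨-, v, hvM, hvN⟩ := id hNY
        have hgv : g.1.1 v = v := hgM v hvM
        have h1 : {p | Γ.inc p N ∧ Γ.inc (g.1.1 p) N} = {v} := by
          ext p
          simp only [Set.mem_ofPred_eq, Set.mem_singleton_iff]
          constructor
          · rintro ⟨hp, hgp⟩
            by_contra hpv
            refine hno N v hxN hvM hvN ?_
            have h2 := (hE.inc_iff g.2 v N).mpr hvN
            rw [hgv] at h2
            exact Γ.eq_of_inc (g.1.1 p) v _ _
              (fun h => hpv (g.1.1.injective (h.trans hgv.symm)))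
              ((hE.inc_iff g.2 p N).mpr hp) h2 hgp hvN
          · rintro rfl
            exact ⟨hvN, by rw [hgv]; exact hvN⟩
        rw [h1, if_pos hNY, Set.ncard_singleton]
      · obtain ⟨w, M', hxM', hwM', hwN⟩ := Γ.exists_proj hxN
        have hM' : M' ≠ M := fun h => hNY ⟨hxN, w, h ▸ hwM', hwN⟩
        have h1 : {p | Γ.inc p N ∧ Γ.inc (g.1.1 p) N} = ∅ := by
          rw [Set.eq_empty_iff_forall_notMem]
          rintro p ⟨hp, hgp⟩
          refine hgS M' hxM' hM' (hstar g.1 g.2 w M' (fun h => hxN (h ▸ hwN)) hxM' hwM' ?_)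
          by_cases hpw : p = w
          · subst hpw
            by_contra hne
            exact not_collinear_of_ne hxN hxM' hwM' hwN hgp hne
              ⟨M', hxM', (hE.inc_map g.2 hxM').mpr hwM'⟩
          · have hp' := not_collinear_of_ne hxN hxM' hwM' hwN hp hpw
            exact (hE.map_proj g.2 hxM' (fun h => hp' ⟨M', hxM', h⟩) hp hwN hwM' hgp hwN hwM').1
        rw [h1, if_neg hNY, Set.ncard_empty]
  have hsum : ∑ N : B, {p | Γ.inc p N ∧ Γ.inc (g.1.1 p) N}.ncard
      = (s + 1) * (t + 1) + s * t := by
    have e : ∀ (Z : Set B) [DecidablePred (· ∈ Z)] (c : ℕ), ∑ N : B, (if N ∈ Z then c else 0) = c * Z.ncard := by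
      intro Z _ c
      rw [← Finset.sum_filter, Finset.sum_const, smul_eq_mul, Nat.mul_comm,
        Set.ncard_eq_toFinset_card']
      congr 2
      ext; simp
    rw [Finset.sum_congr rfl fun N _ => hterm N, Finset.sum_add_distrib, e, e, Γ.ncard_lines,
      hYcard, one_mul]
  obtain ⟨z, hz⟩ := Γ.benson (by omega) g.1 (hE.le_aut g.2)
  rw [hsum] at hz
  push_cast at hz
  have hz' : ((s * t : ℕ) : ℤ) = ((s + t : ℕ) : ℤ) * z := by push_cast; linarith
  exact Int.natCast_dvd_natCast.mp ⟨z, hz'⟩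

end GenQuad

/-! ### The main theorem -/

theorem mainTheorem11 {P B : Type*} [Finite P] [Finite B] {s t : ℕ} (hs : 1 < s) (ht : 1 < t)
    (Γ : GenQuad P B s t) (x : P) (H : Subgroup (Equiv.Perm P × Equiv.Perm B))
    (hST : Γ.IsSTGQ x H) (hstar : Γ.HasStar x H) (hpar : Even s → s ≠ t)
    (hel : ∀ L : B, ¬ Γ.inc x L → IsElementaryAbelian (lineStabilizer H L)) :
    (s ≠ t → (1 : ℚ) < (s : ℚ) / (t : ℚ)) ∧
    (∀ (L M : B) (u : P), ¬ Γ.inc x L → Γ.inc x M → Γ.inc u M → Γ.inc u L →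
      (s : ℚ) / (t : ℚ) ≤
        (Nat.card ↥(lineStabilizer H L ⊓ Γ.rootElations x M u) : ℚ)) ∧
    IsElementaryAbelian (Γ.symmetryGroup x H) := by
  classical
  have hE := hST.toIsEGQ
  have hs0 : 0 < s := by omega
  have ht0 : 0 < t := by omega
  have hab : ∀ L : B, ¬ Γ.inc x L → ∀ a ∈ lineStabilizer H L, ∀ b ∈ lineStabilizer H L,
      a * b = b * a := fun L hL => (hel L hL).1
  set S := (Γ.symmetryGroup x H).subgroupOf H with hS
  -- the Kantor family of a choice of affine lines, and its properties
  have key : ∀ (u : {M // Γ.inc x M} → P) (ℓ : {M // Γ.inc x M} → B),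
      (∀ M, ¬ Γ.inc x (ℓ M)) → (∀ M, Γ.inc (u M) M.1) → (∀ M, Γ.inc (u M) (ℓ M)) →
      ∃ (K A : {M // Γ.inc x M} → Subgroup H) (p : ℕ), p.Prime ∧
        (∀ M, A M = (lineStabilizer H (ℓ M)).subgroupOf H) ∧
        (∀ M, K M = Γ.pointwiseStabilizer H M.1) ∧
        IsSkewKantorFamily S K A s t ∧ Group.IsNilpotent H ∧
        (∀ i, ∀ g ∈ K i, g ∉ S → ∃ y, y * g * y⁻¹ ∈ A i) ∧ ∀ σ ∈ S, σ ^ p = 1 := by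
    intro u ℓ hxℓ huM huℓ
    have hK := Γ.isSkewKantorFamily hST hstar hs0 ht0 hab u ℓ hxℓ huM huℓ
    obtain ⟨L₀, hL₀⟩ : ∃ L, Γ.inc x L := by
      refine Set.nonempty_of_ncard_ne_zero (s := {L | Γ.inc x L}) ?_
      rw [Γ.ncard_lines]; omega
    set i₀ : {M // Γ.inc x M} := ⟨L₀, hL₀⟩
    -- The prime of a single stabilizer suffices: it makes s a power of p, and later all of `H` a
    -- p-group.
    obtain ⟨p, hp, hpow⟩ := (hel (ℓ i₀) (hxℓ i₀)).2
    have := Fact.mk hp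
    have hpowA : ∀ a ∈ (lineStabilizer H (ℓ i₀)).subgroupOf H, a ^ p = 1 := fun a ha =>
      Subtype.ext (hpow a.1 ha)
    have hpA : IsPGroup p ((lineStabilizer H (ℓ i₀)).subgroupOf H) := fun a =>
      ⟨1, by ext1; simpa using hpowA a a.2⟩
    obtain ⟨n, hn⟩ := hpA.exists_card_eq
    rw [hK.card_A] at hn
    have hdvd := not_add_dvd_mul_of_prime_pow hp hn hs ht0 (hK.le_of_one_lt hs) hpar
    have hconj : ∀ i : {M // Γ.inc x M}, ∀ g ∈ Γ.pointwiseStabilizer H i.1, g ∉ S →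
        ∃ y, y * g * y⁻¹ ∈ (lineStabilizer H (ℓ i)).subgroupOf H := by
      intro i g hg hgS
      obtain ⟨N, v, hxN, hvM, hvN, hgN⟩ := Γ.exists_fixed_affine_line hE hstar hs0 ht0 hdvd
        hK.card_group i.2 hg (by
          intro M' hxM' hne hg'
          refine hgS ?_
          rw [hS, ← hK.inf_eq i ⟨M', hxM'⟩ (fun h => hne (congrArg Subtype.val h).symm)]
          exact ⟨hg, hg'⟩)
      obtain ⟨y, hy, hyN, -⟩ := hE.exists_map_line hs0 i.2 hxN hvM hvN (hxℓ i) (huM i) (huℓ i)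
      refine ⟨⟨y, hy⟩, GenQuad.mem_lineStabilizer_subgroupOf.mpr ?_⟩
      have h1 : y.2⁻¹ (ℓ i) = N := by rw [Equiv.Perm.inv_eq_iff_eq, hyN]
      simp only [Subgroup.coe_mul, Subgroup.coe_inv, Prod.snd_mul, Prod.snd_inv,
        Equiv.Perm.mul_apply, h1, hgN, hyN]
    exact ⟨_, _, p, hp, fun _ => rfl, fun _ => rfl, hK,
      (hK.isPGroup hs hconj i₀ hpowA).isNilpotent, hconj,
      fun σ hσ => hK.pow_prime_eq_one hs hconj i₀ hpowA hσ⟩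
  choose u₀ ℓ₀ hxℓ₀ huM₀ huℓ₀ using fun M : {M // Γ.inc x M} => Γ.exists_affine_line hs0 ht0 M.2
  obtain ⟨K, A, p, hp, -, -, hK, hnil, hconj, hpow⟩ := key u₀ ℓ₀ hxℓ₀ huM₀ huℓ₀
  have hts := hK.le_of_one_lt hs
  have htQ : (0 : ℚ) < t := by exact_mod_cast ht0
  refine ⟨fun hne => ?_, ?_, ?_, p, hp, ?_⟩
  · rw [one_lt_div htQ]
    exact_mod_cast lt_of_le_of_ne hts (Ne.symm hne)
  · intro L M u hxL hxM huM huL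
    let i : {M // Γ.inc x M} := ⟨M, hxM⟩
    -- The choice of affine lines is altered at `M` so that the given `L` belongs to the family.
    obtain ⟨K, A, -, -, hA, hKM, hK, hnil, hconj, -⟩ := key (Function.update u₀ i u)
      (Function.update ℓ₀ i L)
      (by intro M'; by_cases h : M' = i <;> simp [Function.update, h, hxL, hxℓ₀])
      (by
        intro M'
        by_cases h : M' = i
        · subst h; simpa using huM
        · simpa [Function.update, h] using huM₀ M')
      (by
        intro M'
        by_cases h : M' = i
        · subst h; simpa using huL
        · simpa [Function.update, h] using huℓ₀ M')
    have hAi : A i = (lineStabilizer H L).subgroupOf H := by rw [hA]; simp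
    have h1 := hK.le_card_centralizer hs hconj i
    have hmem : ∀ g ∈ A i ⊓ Subgroup.centralizer (S : Set H),
        g.1 ∈ lineStabilizer H L ⊓ Γ.rootElations x M u := by
      rintro g ⟨hgA, hgC⟩
      have hgK : Γ.FixesPointwise M g.1 := by
        have := hK.le i hgA
        rwa [hKM] at this
      rw [hAi] at hgA
      have hgL := GenQuad.mem_lineStabilizer_subgroupOf.mp hgA
      have hux : u ≠ x := fun h => hxL (h ▸ huL)
      refine ⟨hgA, hE.le_aut g.2, hE.linewise g.1 g.2, ?_, hgK⟩
      intro N huN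
      by_cases hxN : Γ.inc x N
      · exact hE.linewise g.1 g.2 N hxN
      -- Some symmetry σ maps `L` to `N`; as g fixes `L` and commutes with σ, it fixes `N`.
      · obtain ⟨y, hy, hyL, hyu⟩ := hE.exists_map_line hs0 hxM hxL huM huL hxN huM huN
        have hyK : (⟨y, hy⟩ : H) ∈ K i := by
          rw [hKM]
          exact hstar y hy u M hux hxM huM hyu
        obtain ⟨σ, hσ, a, ha, hσa⟩ := hK.exists_base_mul hyK
        rw [hAi] at ha
        have hσL : σ.1.2 L = N := by
          have h2 : ((⟨y, hy⟩ : H) : Equiv.Perm P × Equiv.Perm B).2 L = N := hyL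
          rw [hσa, Subgroup.coe_mul, Prod.snd_mul, Equiv.Perm.mul_apply,
            GenQuad.mem_lineStabilizer_subgroupOf.mp ha] at h2
          exact h2
        have hcomm : (σ * g).1.2 L = (g * σ).1.2 L := by
          rw [Subgroup.mem_centralizer_iff.mp hgC σ hσ]
        simp only [Subgroup.coe_mul, Prod.snd_mul, Equiv.Perm.mul_apply, hgL, hσL] at hcomm
        exact hcomm.symm
    have h2 : Nat.card ↥(A i ⊓ Subgroup.centralizer (S : Set H))
        ≤ Nat.card ↥(lineStabilizer H L ⊓ Γ.rootElations x M u) :=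
      Nat.card_le_card_of_injective (fun g => ⟨g.1.1, hmem g.1 g.2⟩) (fun a b hab =>
        Subtype.ext (Subtype.ext (congrArg (fun z => z.1) hab)))
    rw [div_le_iff₀ htQ, mul_comm]
    exact_mod_cast h1.trans (Nat.mul_le_mul_left t h2)
  · intro a ha b hb
    exact congrArg Subtype.val
      (hK.commute_base hs hconj (σ := ⟨a, ha.1⟩) (τ := ⟨b, hb.1⟩) ha hb)
  · intro a ha
    exact congrArg Subtype.val (hpow ⟨a, ha.1⟩ ha)
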